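/- **Theorem 4.1.** *Notation.* Let $N,M\ge 1$. For size vectors $I=(I_1,\dots,I_k)$, $J=(J_1,\dots,J_l)$ with $k,l\in\{N,M\}$ let $\mathbb H^{I\times J}$ be the set of quaternion tensors with row multi-indices in $[I_1]\times\dots\times[I_k]$ and column multi-indices in $[J_1]\times\dots\times[J_l]$. Products are Einstein products $(AB)_{ik}=\sum_j a_{ij}b_{jk}$ (sum over multi-indices), $\mathcal I$ is the unit tensor, $^*$ the conjugate transpose, $D^\dagger$ the Moore–Penrose inverse (the unique $X$ with $DXD=D$, $XDX=X$, $(DX)^*=DX$, $(XD)^*=XD$), $L_D=\mathcal I-D^\dagger D$ and $R_D=\mathcal I-DD^\dagger$. The block tensor $[A\ \ B]$ has column size vector $(J_s+K_s)_s$ if $A,B$ have column size vectors $J,K$: its entry at column index $l$ is that of $A$ at $l$ if $l_s\le J_s$ for all $s$, that of $B$ at $(l_s-J_s)_s$ if $l_s>J_s$ for all $s$, and $0$ otherwise; $\begin{bmatrix}A\\B\end{bmatrix}$ is defined in the same way for row indices. For a triple $t=(A,B,E)$ of tensors for which $AXB=E$ makes sense put $$\pi(t)=A^\dagger EB^\dagger,\qquad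 \Gamma(t;W,W')=\pi(t)+L_AW+W'R_B,$$ and let $\mathrm{C}(t)$ be the conditions $R_AE=0$, $EL_B=0$. For a quintuple $t=(F,G,H,J,E)$ for which $FXG+HYJ=E$ makes sense put $M_t=R_FH$, $N_t=JL_G$, $S_t=HL_{M_t}$, $$\xi(t)=F^\dagger EG^\dagger-F^\dagger HM_t^\dagger EG^\dagger-F^\dagger S_tH^\dagger EN_t^\dagger JG^\dagger,\qquad \upsilon(t)=M_t^\dagger EJ^\dagger+S_t^\dagger S_tH^\dagger EN_t^\dagger,$$ $$\Xi(t;U_2,U_4,U_5)=\xi(t)-F^\dagger S_tU_2R_{N_t}JG^\dagger+L_FU_4+U_5R_G,$$ $$\Upsilon(t;U_1,U_2,U_3)=\upsilon(t)+L_{M_t}L_{S_t}U_1+L_{M_t}U_2R_{N_t}+U_3R_J,$$ and let $\mathrm C(t)$ be the conditions $R_{M_t}R_FE=0$, $EL_GL_{N_t}=0$, $R_FEL_J=0$, $R_HEL_G=0$. For $A=[A'\ A'']$, $B=\begin{bmatrix}B'\\B''\end{bmatrix}$ with $A',A''\in\mathbb H^{p\times p}$, $B',B''\in\mathbb H^{q\times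 q}$, and $C\in\mathbb H^{p\times q}$, the assignment $(X_1,X_2;Y_1,Y_2)\leftarrow(A,B,C)$ means $$X_1=[\mathcal I\ 0]X,\quad X_2=[0\ \mathcal I]X,\quad Y_1=Y\begin{bmatrix}\mathcal I\\0\end{bmatrix},\quad Y_2=Y\begin{bmatrix}0\\\mathcal I\end{bmatrix},$$ $$X=A^\dagger C-VB+L_AV',\qquad Y=R_ACB^\dagger+AV+V''R_B,$$ where $V,V',V''$ are arbitrary tensors of the appropriate sizes (a new triple for every assignment). *The system.* Let $F_i,G_i,H_i,J_i$ $(i=1,\dots,4)$ and $E_1,\dots,E_5$ be given quaternion tensors such that the system $$F_4Z_1G_4=E_4,\qquad F_iZ_iG_i+H_iZ_{i+1}J_i=E_i\ \ (i=1,2,3),\qquad H_4Z_4J_4=E_5\tag{1.4}$$ makes sense for unknowns $Z_i\in\mathbb H^{p_i\times q_i}$, where all row size vectors of the $E_i$ and all $p_i$ have length $N$, and all column size vectors of the $E_i$ and all $q_i$ have length $M$. Put $t_i=(F_i,G_i,H_i,J_i,E_i)$ and $\widehat M_i=M_{t_i}$, $\widehat N_i=N_{t_i}$, $\widehat S_i=S_{t_i}$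 for $i=1,2,3$, and $t_4=(F_4,G_4,E_4)$, $t_5=(H_4,J_4,E_5)$. Set 1. $A_{11}=[L_{F_4}\ \ {-L_{F_1}}]$, $D_{11}=\begin{bmatrix}R_{G_4}\\-R_{G_1}\end{bmatrix}$, $\widehat A_1=F_1^\dagger\widehat S_1$, $\widehat B_1=R_{\widehat N_1}J_1G_1^\dagger$, $E_{11}=\xi(t_1)-\pi(t_4)$; $A_{22}=[L_{H_4}\ \ {-L_{\widehat M_3}L_{\widehat S_3}}]$, $D_{22}=\begin{bmatrix}R_{J_4}\\-R_{J_3}\end{bmatrix}$, $\widehat A_2=-L_{\widehat M_3}$, $\widehat B_2=R_{\widehat N_3}$, $E_{22}=\upsilon(t_3)-\pi(t_5)$; and $\hat t_i=(\widehat A_{ii},\widehat B_{ii},\widehat E_{ii})=(R_{A_{ii}}\widehat A_i,\ \widehat B_iL_{D_{ii}},\ R_{A_{ii}}E_{ii}L_{D_{ii}})$ for $i=1,2$. 2. For $i=1,2$: $\bar A_i=[-L_{\widehat M_i}L_{\widehat S_i}\ \ L_{F_{i+1}}]$, $\bar B_i=\begin{bmatrix}-R_{J_i}\\R_{G_{i+1}}\end{bmatrix}$,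 $\bar F_i=F_{i+1}^\dagger\widehat S_{i+1}$, $\bar G_i=R_{\widehat N_{i+1}}J_{i+1}G_{i+1}^\dagger$, $\bar H_i=L_{\widehat M_i}$, $\bar J_i=R_{\widehat N_i}$, $\bar E_i=-\upsilon(t_i)+\xi(t_{i+1})$; and $\bar t_i=(\bar F_{ii},\bar G_{ii},\bar H_{ii},\bar J_{ii},\bar E_{ii})=(R_{\bar A_i}\bar F_i,\ \bar G_iL_{\bar B_i},\ R_{\bar A_i}\bar H_i,\ \bar J_iL_{\bar B_i},\ R_{\bar A_i}\bar E_iL_{\bar B_i})$, $\bar M_{ii}=M_{\bar t_i}$, $\bar N_{ii}=N_{\bar t_i}$, $\bar S_{ii}=S_{\bar t_i}$. 3. $\bar{\bar A}_1=[L_{\bar F_{11}}\ \ {-L_{\bar M_{22}}L_{\bar S_{22}}}]$, $\bar{\bar B}_1=\begin{bmatrix}R_{\bar G_{11}}\\-R_{\bar J_{22}}\end{bmatrix}$, $\bar{\bar F}_1=\bar F_{11}^\dagger\bar S_{11}$, $\bar{\bar G}_1=R_{\bar N_{11}}\bar J_{11}\bar G_{11}^\dagger$, $\bar{\bar H}_1=L_{\bar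 M_{22}}$, $\bar{\bar J}_1=R_{\bar N_{22}}$, $\bar{\bar E}_1=\xi(\bar t_1)-\upsilon(\bar t_2)$; and $\bar{\bar t}=(\bar{\bar F}_{11},\bar{\bar G}_{11},\bar{\bar H}_{11},\bar{\bar J}_{11},\bar{\bar E}_{11})=(R_{\bar{\bar A}_1}\bar{\bar F}_1,\ \bar{\bar G}_1L_{\bar{\bar B}_1},\ R_{\bar{\bar A}_1}\bar{\bar H}_1,\ \bar{\bar J}_1L_{\bar{\bar B}_1},\ R_{\bar{\bar A}_1}\bar{\bar E}_1L_{\bar{\bar B}_1})$, $\bar{\bar M}_{11}=M_{\bar{\bar t}}$, $\bar{\bar N}_{11}=N_{\bar{\bar t}}$, $\bar{\bar S}_{11}=S_{\bar{\bar t}}$. 4. $\tilde A_1=[L_{\bar M_{11}}L_{\bar S_{11}}\ \ {-L_{\widehat A_{11}}}]$, $\tilde B_1=\begin{bmatrix}R_{\bar J_{11}}\\-R_{\widehat B_{11}}\end{bmatrix}$, $\tilde C_1=L_{\bar M_{11}}$, $\tilde D_1=R_{\bar N_{11}}$, $\tilde E_1=\pi(\hat t_1)-\upsilon(\bar t_1)$;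 $\tilde A_2=[L_{\widehat A_{22}}\ \ {-L_{\bar F_{22}}}]$, $\tilde B_2=\begin{bmatrix}R_{\widehat B_{22}}\\-R_{\bar G_{22}}\end{bmatrix}$, $\tilde C_2=\bar F_{22}^\dagger\bar S_{22}$, $\tilde D_2=R_{\bar N_{22}}\bar J_{22}\bar G_{22}^\dagger$, $\tilde E_2=\xi(\bar t_2)-\pi(\hat t_2)$; and $\tilde t_i=(\tilde C_{ii},\tilde D_{ii},\tilde E_{ii})=(R_{\tilde A_i}\tilde C_i,\ \tilde D_iL_{\tilde B_i},\ R_{\tilde A_i}\tilde E_iL_{\tilde B_i})$ for $i=1,2$. 5. $\tilde F_1=[L_{\tilde C_{11}}\ \ {-L_{\bar{\bar F}_{11}}}]$, $\tilde G_1=\begin{bmatrix}R_{\tilde D_{11}}\\-R_{\bar{\bar G}_{11}}\end{bmatrix}$, $\tilde H_1=\bar{\bar F}_{11}^\dagger\bar{\bar S}_{11}$, $\tilde J_1=R_{\bar{\bar N}_{11}}\bar{\bar J}_{11}\bar{\bar G}_{11}^\dagger$, $\tilde{\tilde E}_1=\xi(\bar{\bar t})-\pi(\tilde t_1)$; $\tilde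 F_2=[L_{\bar{\bar M}_{11}}L_{\bar{\bar S}_{11}}\ \ {-L_{\tilde C_{22}}}]$, $\tilde G_2=\begin{bmatrix}R_{\bar{\bar J}_{11}}\\-R_{\tilde D_{22}}\end{bmatrix}$, $\tilde H_2=L_{\bar{\bar M}_{11}}$, $\tilde J_2=R_{\bar{\bar N}_{11}}$, $\tilde{\tilde E}_2=\pi(\tilde t_2)-\upsilon(\bar{\bar t})$; and $\tilde{\tilde t}_i=(\tilde H_{ii},\tilde J_{ii},\tilde{\tilde E}_{ii})=(R_{\tilde F_i}\tilde H_i,\ \tilde J_iL_{\tilde G_i},\ R_{\tilde F_i}\tilde{\tilde E}_iL_{\tilde G_i})$ for $i=1,2$. 6. $\tilde A=[L_{\tilde H_{11}}\ \ {-L_{\tilde H_{22}}}]$, $\tilde B=\begin{bmatrix}R_{\tilde J_{11}}\\-R_{\tilde J_{22}}\end{bmatrix}$, $\tilde E=\pi(\tilde{\tilde t}_2)-\pi(\tilde{\tilde t}_1)$. *Claim.* The system (1.4) is consistent if and only if $\mathrm C(t_1),\dots,\mathrm C(t_5)$, $\mathrm C(\hat t_1)$, $\mathrm C(\hat t_2)$,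 $\mathrm C(\bar t_1)$, $\mathrm C(\bar t_2)$, $\mathrm C(\bar{\bar t})$, $\mathrm C(\tilde t_1)$, $\mathrm C(\tilde t_2)$, $\mathrm C(\tilde{\tilde t}_1)$, $\mathrm C(\tilde{\tilde t}_2)$ all hold and $R_{\tilde A}\tilde EL_{\tilde B}=0$. Under these conditions the general solution of (1.4) is $$Z_1=\Gamma(t_4;W_1,W_2)=\Xi(t_1;\widehat U_2,\widehat U_4,\widehat U_5),\qquad Z_2=\Upsilon(t_1;\widehat U_1,\widehat U_2,\widehat U_3)=\Xi(t_2;\widehat V_2,\widehat V_4,\widehat V_5),$$ $$Z_3=\Upsilon(t_2;\widehat V_1,\widehat V_2,\widehat V_3)=\Xi(t_3;\widehat K_2,\widehat K_4,\widehat K_5),\qquad Z_4=\Gamma(t_5;\widehat W_1,W_3)=\Upsilon(t_3;\widehat K_1,\widehat K_2,\widehat K_3),$$ where the parameters are obtained successively from $$(T_{33},T_{55};T_{44},T_{66})\leftarrow(\tilde A,\tilde B,\tilde E),\qquad K_{44}=\Gamma(\tilde{\tilde t}_1;T_{33},T_{44})=\Gamma(\tilde{\tilde t}_2;T_{55},T_{66}),$$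 $$(W_{88},K_{55};W_{99},K_{66})\leftarrow(\tilde F_1,\tilde G_1,\tilde{\tilde E}_1-\tilde H_1K_{44}\tilde J_1),\qquad (K_{77},T_{11};K_{88},T_{22})\leftarrow(\tilde F_2,\tilde G_2,\tilde{\tilde E}_2-\tilde H_2K_{44}\tilde J_2),$$ $$P_{44}=\Xi(\bar{\bar t};K_{44},K_{55},K_{66})=\Gamma(\tilde t_1;W_{88},W_{99}),\qquad Q_{55}=\Upsilon(\bar{\bar t};K_{77},K_{44},K_{88})=\Gamma(\tilde t_2;T_{11},T_{22}),$$ $$(P_{55},Q_{77};P_{66},Q_{88})\leftarrow(\bar{\bar A}_1,\bar{\bar B}_1,-\bar{\bar E}_1+\bar{\bar F}_1P_{44}\bar{\bar G}_1+\bar{\bar H}_1Q_{55}\bar{\bar J}_1),$$ $$(Q_{44},V_{77};Q_{66},V_{88})\leftarrow(\tilde A_1,\tilde B_1,\tilde E_1-\tilde C_1P_{44}\tilde D_1),\qquad (V_{99},P_{77};W_{11},P_{88})\leftarrow(\tilde A_2,\tilde B_2,\tilde E_2-\tilde C_2Q_{55}\tilde D_2),$$ $$\widehat V_2=\Xi(\bar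 t_1;P_{44},P_{55},P_{66})=\Upsilon(\bar t_2;Q_{77},Q_{55},Q_{88}),\qquad \widehat U_2=\Upsilon(\bar t_1;Q_{44},P_{44},Q_{66})=\Gamma(\hat t_1;V_{77},V_{88}),$$ $$\widehat K_2=\Xi(\bar t_2;Q_{55},P_{77},P_{88})=\Gamma(\hat t_2;V_{99},W_{11}),$$ $$(\widehat U_1,\widehat V_4;\widehat U_3,\widehat V_5)\leftarrow(\bar A_1,\bar B_1,-\bar E_1+\bar F_1\widehat V_2\bar G_1+\bar H_1\widehat U_2\bar J_1),\qquad (\widehat V_1,\widehat K_4;\widehat V_3,\widehat K_5)\leftarrow(\bar A_2,\bar B_2,-\bar E_2+\bar F_2\widehat K_2\bar G_2+\bar H_2\widehat V_2\bar J_2),$$ $$(W_1,\widehat U_4;W_2,\widehat U_5)\leftarrow(A_{11},D_{11},E_{11}-\widehat A_1\widehat U_2\widehat B_1),\qquad (\widehat W_1,\widehat K_1;W_3,\widehat K_3)\leftarrow(A_{22},D_{22},E_{22}-\widehat A_2\widehat K_2\widehat B_2).$$ That is: for every choice of the arbitrary tensors $V,V',V''$ in the ten assignments, every two expressions above that are set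 equal agree (the parameters being computed with the first expression), and a quadruple $(Z_1,Z_2,Z_3,Z_4)$ solves (1.4) if and only if it arises in this way from some choice of these arbitrary tensors. -/

import Mathlib

namespace EinsteinTensor

/-! ### Quaternion tensors and the Einstein product

For a size vector `I : Fin N → ℕ` the multi-indices `(i_1, …, i_N)`, `i_s ∈ [I_s]`, form the type
`MIdx I`.  A quaternion tensor in `ℍ^{I(N) × J(M)}` is an array with one block of row indices in
`MIdx I` and one block of column indices in `MIdx J`.  With this indexing the Einstein product
`(A * B)_{i k} = ∑_j a_{i j} b_{j k}` (summation over all multi-indices `j`), the conjugate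
transpose, the unit tensor `1` and the zero tensor are Mathlib's operations on `Matrix`. -/

/-- Multi-indices `(i_1, …, i_N)` with `i_s ∈ [I_s]`. -/
abbrev MIdx {N : ℕ} (I : Fin N → ℕ) : Type := (s : Fin N) → Fin (I s)

/-- Quaternion tensors of size `I(N) × J(M)`; the product `*` is the Einstein product. -/
abbrev QTensor {N M : ℕ} (I : Fin N → ℕ) (J : Fin M → ℕ) : Type :=
  Matrix (MIdx I) (MIdx J) (Quaternion ℝ)

/-- The size vector `J_s + K_s`. -/
abbrev addSize {M : ℕ} (J K : Fin M → ℕ) : Fin M → ℕ := fun s => J s + K s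

/-- The row block tensor `[A B]`: the entry at column index `l` is that of `A` if all `l_s` are
among the first `J_s` values, that of `B` if all `l_s` are among the last `K_s` values, and `0`
otherwise. -/
noncomputable def rowBlock {N M : ℕ} {I : Fin N → ℕ} {J K : Fin M → ℕ} (A : QTensor I J) (B : QTensor I K) :
    QTensor I (addSize J K) := fun i l =>
  if h : ∀ s, (l s : ℕ) < J s then A i (fun s => ⟨l s, h s⟩)
  else if h' : ∀ s, J s ≤ (l s : ℕ) then
    B i (fun s => ⟨(l s : ℕ) - J s, by
      have h1 : (l s : ℕ) < J s + K s := (l s).isLt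
      have h2 := h' s
      omega⟩)
  else 0

/-- The column block tensor with upper block `A` and lower block `B`. -/
noncomputable def colBlock {N M : ℕ} {I : Fin N → ℕ} {J K : Fin M → ℕ} (A : QTensor J I) (B : QTensor K I) :
    QTensor (addSize J K) I := fun l i =>
  if h : ∀ s, (l s : ℕ) < J s then A (fun s => ⟨l s, h s⟩) i
  else if h' : ∀ s, J s ≤ (l s : ℕ) then
    B (fun s => ⟨(l s : ℕ) - J s, by
      have h1 : (l s : ℕ) < J s + K s := (l s).isLt
      have h2 := h' s
      omega⟩) i
  else 0

/-! ### The Moore–Penrose inverse -/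

/-- `X` satisfies the four Penrose equations for `D`. -/
def IsMoorePenrose {N M : ℕ} {I : Fin N → ℕ} {J : Fin M → ℕ} (D : QTensor I J)
    (X : QTensor J I) : Prop :=
  D * X * D = D ∧ X * D * X = X ∧ (D * X).conjTranspose = D * X ∧ (X * D).conjTranspose = X * D

theorem exists_inner_inverse {m n : Type} [Fintype m] [Fintype n] [DecidableEq m] [DecidableEq n]
    (A : Matrix m n (Quaternion ℝ)) : ∃ G : Matrix n m (Quaternion ℝ), A * G * A = A := by
  obtain ⟨g', hg'⟩ := (Matrix.toLinearMapRight' A).rangeRestrict.exists_rightInverse_of_surjective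
    (LinearMap.range_rangeRestrict _)
  obtain ⟨g, hg⟩ := LinearMap.exists_extend g'
  refine ⟨LinearMap.toMatrixRight' g, Matrix.toLinearMapRight'.injective ?_⟩
  refine LinearMap.ext fun x => ?_
  rw [Matrix.toLinearMapRight'_mul_apply, Matrix.toLinearMapRight'_mul_apply]
  have h1 : Matrix.toLinearMapRight' (LinearMap.toMatrixRight' g) = g :=
    LinearMap.toMatrixRight'.symm_apply_apply g
  rw [h1]
  have h2 := LinearMap.congr_fun hg ((Matrix.toLinearMapRight' A).rangeRestrict x)
  have h3 := congrArg Subtype.val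
    (LinearMap.congr_fun hg' ((Matrix.toLinearMapRight' A).rangeRestrict x))
  exact (congrArg (Matrix.toLinearMapRight' A) h2).trans h3

theorem eq_zero_of_conjTranspose_mul_self {m n : Type} [Fintype m]
    (A : Matrix m n (Quaternion ℝ)) (h : A.conjTranspose * A = 0) : A = 0 := by
  ext1 i j
  have h1 : ∑ k, star (A k j) * A k j = 0 := by
    have := congrFun (congrFun h j) j
    simpa [Matrix.mul_apply] using this
  have h2 : ∑ k, Quaternion.normSq (A k j) = 0 := by
    simp only [Quaternion.star_mul_self] at h1
    apply Quaternion.coe_injective (R := ℝ)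
    rw [Quaternion.coe_zero, ← h1]
    exact map_sum (algebraMap ℝ (Quaternion ℝ)) _ _
  have h3 := (Finset.sum_eq_zero_iff_of_nonneg (fun k _ => Quaternion.normSq_nonneg)).1 h2 i
    (Finset.mem_univ i)
  simpa using h3

theorem exists_gram_inverse {m n : Type} [Fintype m] [Fintype n] [DecidableEq m] [DecidableEq n]
    (D : Matrix m n (Quaternion ℝ)) :
    ∃ W : Matrix n n (Quaternion ℝ), D * W * D.conjTranspose * D = D := by
  obtain ⟨W, hW⟩ := exists_inner_inverse (D.conjTranspose * D)
  refine ⟨W, sub_eq_zero.1 (eq_zero_of_conjTranspose_mul_self _ ?_)⟩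
  have h0 : D.conjTranspose * (D * W * D.conjTranspose * D - D) = 0 := by
    rw [Matrix.mul_sub, sub_eq_zero]
    simpa only [Matrix.mul_assoc] using hW
  have h1 : D * W * D.conjTranspose * D - D = D * (W * D.conjTranspose * D - 1) := by
    simp only [Matrix.mul_sub, Matrix.mul_assoc, Matrix.mul_one]
  rw [h1] at h0 ⊢
  rw [Matrix.conjTranspose_mul, Matrix.mul_assoc, h0, Matrix.mul_zero]

theorem exists_isMoorePenrose {N M : ℕ} {I : Fin N → ℕ} {J : Fin M → ℕ} (D : QTensor I J) :
    ∃ X, IsMoorePenrose D X := by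
  obtain ⟨W, hW⟩ := exists_gram_inverse D
  obtain ⟨V', hV'⟩ := exists_gram_inverse D.conjTranspose
  set S := D.conjTranspose with hS
  have hSS : S.conjTranspose = D := by rw [hS, Matrix.conjTranspose_conjTranspose]
  have hV : D * S * V'.conjTranspose * D = D := by
    have := congrArg Matrix.conjTranspose hV'
    simp only [Matrix.conjTranspose_mul, hSS] at this
    rw [← hS] at this
    simpa only [Matrix.mul_assoc] using this
  generalize V'.conjTranspose = V at hV
  have hWs : S * D * W.conjTranspose * S = S := by
    have := congrArg Matrix.conjTranspose hW
    simp only [Matrix.conjTranspose_mul, hSS] at this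
    rw [← hS] at this
    simpa only [Matrix.mul_assoc] using this
  have hVs : S * V.conjTranspose * D * S = S := by
    have := congrArg Matrix.conjTranspose hV
    simp only [Matrix.conjTranspose_mul, hSS] at this
    rw [← hS] at this
    simpa only [Matrix.mul_assoc] using this
  have e1 : D * (S * V * D * W * S) = D * W * S := by
    calc D * (S * V * D * W * S) = (D * S * V * D) * W * S := by simp only [Matrix.mul_assoc]
      _ = D * W * S := by rw [hV]
  have e2 : (S * V * D * W * S) * D = S * V * D := by
    calc (S * V * D * W * S) * D = S * V * (D * W * S * D) := by simp only [Matrix.mul_assoc]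
      _ = S * V * D := by rw [hW]
  refine ⟨S * V * D * W * S, ?_, ?_, ?_, ?_⟩
  · rw [e1, hW]
  · rw [e2]
    calc S * V * D * (S * V * D * W * S) = S * V * (D * (S * V * D * W * S)) := by
          simp only [Matrix.mul_assoc]
      _ = S * V * D * W * S := by rw [e1]; simp only [Matrix.mul_assoc]
  · rw [e1]
    have a1 : (D * W * S).conjTranspose = D * W.conjTranspose * S := by
      simp only [Matrix.conjTranspose_mul, hSS, ← hS, Matrix.mul_assoc]
    rw [a1]
    calc D * W.conjTranspose * S = (D * W * S * D) * W.conjTranspose * S := by rw [hW]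
      _ = D * W * (S * D * W.conjTranspose * S) := by simp only [Matrix.mul_assoc]
      _ = D * W * S := by rw [hWs]
  · rw [e2]
    have a1 : (S * V * D).conjTranspose = S * V.conjTranspose * D := by
      simp only [Matrix.conjTranspose_mul, hSS, ← hS, Matrix.mul_assoc]
    rw [a1]
    calc S * V.conjTranspose * D = S * V.conjTranspose * (D * S * V * D) := by rw [hV]
      _ = (S * V.conjTranspose * D * S) * V * D := by simp only [Matrix.mul_assoc]
      _ = S * V * D := by rw [hVs]

theorem IsMoorePenrose.unique {N M : ℕ} {I : Fin N → ℕ} {J : Fin M → ℕ} {D : QTensor I J}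
    {X Y : QTensor J I} (hX : IsMoorePenrose D X) (hY : IsMoorePenrose D Y) : X = Y := by
  obtain ⟨x1, x2, x3, x4⟩ := hX
  obtain ⟨y1, y2, y3, y4⟩ := hY
  have h1 : D * X = D * Y := by
    calc D * X = (D * X).conjTranspose := x3.symm
      _ = (D * Y * (D * X)).conjTranspose := by rw [← Matrix.mul_assoc, y1]
      _ = (D * X) * (D * Y) := by rw [Matrix.conjTranspose_mul, x3, y3]
      _ = D * Y := by rw [← Matrix.mul_assoc, x1]
  have h2 : X * D = Y * D := by
    calc X * D = (X * D).conjTranspose := x4.symm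
      _ = (X * D * (Y * D)).conjTranspose := by
          rw [Matrix.mul_assoc X D, ← Matrix.mul_assoc D Y, y1]
      _ = (Y * D) * (X * D) := by rw [Matrix.conjTranspose_mul, x4, y4]
      _ = Y * D := by rw [Matrix.mul_assoc Y D, ← Matrix.mul_assoc D X, x1]
  calc X = X * D * X := x2.symm
    _ = Y * D * Y := by rw [h2, Matrix.mul_assoc, h1, ← Matrix.mul_assoc]
    _ = Y := y2

/-- The Moore–Penrose inverse: the unique solution of the four Penrose equations. -/
noncomputable def mpInv {N M : ℕ} {I : Fin N → ℕ} {J : Fin M → ℕ} (D : QTensor I J) :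
    QTensor J I :=
  (exists_isMoorePenrose D).choose

theorem mpInv_spec {N M : ℕ} {I : Fin N → ℕ} {J : Fin M → ℕ} (D : QTensor I J) :
    IsMoorePenrose D (mpInv D) :=
  (exists_isMoorePenrose D).choose_spec

/-- The projection `L_D = I - D† * D`. -/
noncomputable def projL {N M : ℕ} {I : Fin N → ℕ} {J : Fin M → ℕ} (D : QTensor I J) :
    QTensor J J := 1 - mpInv D * D

/-- The projection `R_D = I - D * D†`. -/
noncomputable def projR {N M : ℕ} {I : Fin N → ℕ} {J : Fin M → ℕ} (D : QTensor I J) :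
    QTensor I I := 1 - D * mpInv D

/-! ### Coefficient data of the one- and two-term equations that occur -/

/-- The data `(A, B, E)` of the equation `A * X * B = E`. -/
structure OneTerm {N M : ℕ} (a p : Fin N → ℕ) (q b : Fin M → ℕ) where
  A : QTensor a p
  B : QTensor q b
  E : QTensor a b

namespace OneTerm

variable {N M : ℕ} {a p : Fin N → ℕ} {q b : Fin M → ℕ} (t : OneTerm a p q b)

/-- `R_A * E = 0` and `E * L_B = 0`. -/
def Cond : Prop := projR t.A * t.E = 0 ∧ t.E * projL t.B = 0

/-- `A† * E * B†`. -/
noncomputable def part : QTensor p q := mpInv t.A * t.E * mpInv t.B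

/-- `A† * E * B† + L_A * W + W' * R_B`. -/
noncomputable def gen (W W' : QTensor p q) : QTensor p q :=
  t.part + projL t.A * W + W' * projR t.B

end OneTerm

/-- The data `(F, G, H, J, E)` of the equation `F * X * G + H * Y * J = E`. -/
structure TwoTerm {N M : ℕ} (a p p' : Fin N → ℕ) (q q' b : Fin M → ℕ) where
  F : QTensor a p
  G : QTensor q b
  H : QTensor a p'
  J : QTensor q' b
  E : QTensor a b

namespace TwoTerm

variable {N M : ℕ} {a p p' : Fin N → ℕ} {q q' b : Fin M → ℕ} (t : TwoTerm a p p' q q' b)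

/-- `M = R_F * H`. -/
noncomputable def Mt : QTensor a p' := projR t.F * t.H

/-- `N = J * L_G`. -/
noncomputable def Nt : QTensor q' b := t.J * projL t.G

/-- `S = H * L_M`. -/
noncomputable def St : QTensor a p' := t.H * projL t.Mt

/-- The four conditions `R_M R_F E = 0`, `E L_G L_N = 0`, `R_F E L_J = 0`, `R_H E L_G = 0`. -/
def Cond : Prop :=
  projR t.Mt * projR t.F * t.E = 0 ∧ t.E * projL t.G * projL t.Nt = 0 ∧
    projR t.F * t.E * projL t.J = 0 ∧ projR t.H * t.E * projL t.G = 0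

/-- `F† E G† - F† H M† E G† - F† S H† E N† J G†`. -/
noncomputable def partX : QTensor p q :=
  mpInv t.F * t.E * mpInv t.G - mpInv t.F * t.H * mpInv t.Mt * t.E * mpInv t.G
    - mpInv t.F * t.St * mpInv t.H * t.E * mpInv t.Nt * t.J * mpInv t.G

/-- `M† E J† + S† S H† E N†`. -/
noncomputable def partY : QTensor p' q' :=
  mpInv t.Mt * t.E * mpInv t.J + mpInv t.St * t.St * mpInv t.H * t.E * mpInv t.Nt

/-- The general first unknown: `partX - F† S U₂ R_N J G† + L_F U₄ + U₅ R_G`. -/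
noncomputable def genX (U₂ : QTensor p' q') (U₄ U₅ : QTensor p q) : QTensor p q :=
  t.partX - mpInv t.F * t.St * U₂ * projR t.Nt * t.J * mpInv t.G + projL t.F * U₄
    + U₅ * projR t.G

/-- The general second unknown: `partY + L_M L_S U₁ + L_M U₂ R_N + U₃ R_J`. -/
noncomputable def genY (U₁ U₂ U₃ : QTensor p' q') : QTensor p' q' :=
  t.partY + projL t.Mt * projL t.St * U₁ + projL t.Mt * U₂ * projR t.Nt + U₃ * projR t.J

end TwoTerm

/-! ### Reading off the four blocks of `A * X + Y * B = C` -/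

/-- Three free tensors for an equation `A * X + Y * B = C` in which `A` is a row block tensor
with two blocks, `B` is a column block tensor with two blocks, and `C` has size `p × q`. -/
structure Free {N M : ℕ} (p : Fin N → ℕ) (q : Fin M → ℕ) where
  V : QTensor (addSize p p) (addSize q q)
  V' : QTensor (addSize p p) q
  V'' : QTensor p (addSize q q)

namespace Free

variable {N M : ℕ} {p : Fin N → ℕ} {q : Fin M → ℕ}

/-- `X = A† C - V B + L_A V'`. -/
noncomputable def X (v : Free p q) (A : QTensor p (addSize p p)) (B : QTensor (addSize q q) q)
    (C : QTensor p q) : QTensor (addSize p p) q :=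
  mpInv A * C - v.V * B + projL A * v.V'

/-- `Y = R_A C B† + A V + V'' R_B`. -/
noncomputable def Y (v : Free p q) (A : QTensor p (addSize p p)) (B : QTensor (addSize q q) q)
    (C : QTensor p q) : QTensor p (addSize q q) :=
  projR A * C * mpInv B + A * v.V + v.V'' * projR B

/-- The upper block `[I 0] * X`. -/
noncomputable def X₁ (v : Free p q) (A : QTensor p (addSize p p)) (B : QTensor (addSize q q) q)
    (C : QTensor p q) : QTensor p q :=
  rowBlock (1 : QTensor p p) (0 : QTensor p p) * v.X A B C

/-- The lower block `[0 I] * X`. -/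
noncomputable def X₂ (v : Free p q) (A : QTensor p (addSize p p)) (B : QTensor (addSize q q) q)
    (C : QTensor p q) : QTensor p q :=
  rowBlock (0 : QTensor p p) (1 : QTensor p p) * v.X A B C

/-- The left block `Y * [I; 0]`. -/
noncomputable def Y₁ (v : Free p q) (A : QTensor p (addSize p p)) (B : QTensor (addSize q q) q)
    (C : QTensor p q) : QTensor p q :=
  v.Y A B C * colBlock (1 : QTensor q q) (0 : QTensor q q)

/-- The right block `Y * [0; I]`. -/
noncomputable def Y₂ (v : Free p q) (A : QTensor p (addSize p p)) (B : QTensor (addSize q q) q)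
    (C : QTensor p q) : QTensor p q :=
  v.Y A B C * colBlock (0 : QTensor q q) (1 : QTensor q q)

end Free

/-! ### The coupled system -/

/-- The given tensors of the coupled system
`F₄ Z₁ G₄ = E₄`, `F_i Z_i G_i + H_i Z_{i+1} J_i = E_i` (`i = 1, 2, 3`), `H₄ Z₄ J₄ = E₅`.
The sizes are arbitrary, subject only to all products being defined: `Z_i` has size `p_i × q_i`
and `E_i` has size `a_i × b_i`. -/
structure CoupledSystem (N M : ℕ) where
  (p₁ p₂ p₃ p₄ a₁ a₂ a₃ a₄ a₅ : Fin N → ℕ)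
  (q₁ q₂ q₃ q₄ b₁ b₂ b₃ b₄ b₅ : Fin M → ℕ)
  F₁ : QTensor a₁ p₁
  G₁ : QTensor q₁ b₁
  H₁ : QTensor a₁ p₂
  J₁ : QTensor q₂ b₁
  E₁ : QTensor a₁ b₁
  F₂ : QTensor a₂ p₂
  G₂ : QTensor q₂ b₂
  H₂ : QTensor a₂ p₃
  J₂ : QTensor q₃ b₂
  E₂ : QTensor a₂ b₂
  F₃ : QTensor a₃ p₃
  G₃ : QTensor q₃ b₃
  H₃ : QTensor a₃ p₄
  J₃ : QTensor q₄ b₃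
  E₃ : QTensor a₃ b₃
  F₄ : QTensor a₄ p₁
  G₄ : QTensor q₁ b₄
  E₄ : QTensor a₄ b₄
  H₄ : QTensor a₅ p₄
  J₄ : QTensor q₄ b₅
  E₅ : QTensor a₅ b₅

namespace CoupledSystem

variable {N M : ℕ} (c : CoupledSystem N M)

/-- `(Z₁, Z₂, Z₃, Z₄)` solves the coupled system. -/
def IsSolution (Z₁ : QTensor c.p₁ c.q₁) (Z₂ : QTensor c.p₂ c.q₂) (Z₃ : QTensor c.p₃ c.q₃)
    (Z₄ : QTensor c.p₄ c.q₄) : Prop :=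
  c.F₄ * Z₁ * c.G₄ = c.E₄ ∧
  c.F₁ * Z₁ * c.G₁ + c.H₁ * Z₂ * c.J₁ = c.E₁ ∧
  c.F₂ * Z₂ * c.G₂ + c.H₂ * Z₃ * c.J₂ = c.E₂ ∧
  c.F₃ * Z₃ * c.G₃ + c.H₃ * Z₄ * c.J₃ = c.E₃ ∧
  c.H₄ * Z₄ * c.J₄ = c.E₅

/-- The system has a solution. -/
def Consistent : Prop := ∃ Z₁ Z₂ Z₃ Z₄, c.IsSolution Z₁ Z₂ Z₃ Z₄

/-! The five equations of the system.  For `i = 1, 2, 3` the tensors `M̂_i`, `N̂_i`, `Ŝ_i` are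
`c.eq_i.Mt`, `c.eq_i.Nt`, `c.eq_i.St`. -/

def first : OneTerm c.a₄ c.p₁ c.q₁ c.b₄ := ⟨c.F₄, c.G₄, c.E₄⟩
def eq₁ : TwoTerm c.a₁ c.p₁ c.p₂ c.q₁ c.q₂ c.b₁ := ⟨c.F₁, c.G₁, c.H₁, c.J₁, c.E₁⟩
def eq₂ : TwoTerm c.a₂ c.p₂ c.p₃ c.q₂ c.q₃ c.b₂ := ⟨c.F₂, c.G₂, c.H₂, c.J₂, c.E₂⟩
def eq₃ : TwoTerm c.a₃ c.p₃ c.p₄ c.q₃ c.q₄ c.b₃ := ⟨c.F₃, c.G₃, c.H₃, c.J₃, c.E₃⟩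
def last : OneTerm c.a₅ c.p₄ c.q₄ c.b₅ := ⟨c.H₄, c.J₄, c.E₅⟩

/-! Tensors built from the two expressions for `Z₁` and the two expressions for `Z₄`. -/

noncomputable def A₁₁ : QTensor c.p₁ (addSize c.p₁ c.p₁) :=
  rowBlock (projL c.F₄) (-projL c.F₁)
noncomputable def D₁₁ : QTensor (addSize c.q₁ c.q₁) c.q₁ :=
  colBlock (projR c.G₄) (-projR c.G₁)
noncomputable def Ahat₁ : QTensor c.p₁ c.p₂ := mpInv c.F₁ * c.eq₁.St
noncomputable def Bhat₁ : QTensor c.q₂ c.q₁ := projR c.eq₁.Nt * c.J₁ * mpInv c.G₁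
noncomputable def E₁₁ : QTensor c.p₁ c.q₁ := c.eq₁.partX - c.first.part
noncomputable def A₂₂ : QTensor c.p₄ (addSize c.p₄ c.p₄) :=
  rowBlock (projL c.H₄) (-(projL c.eq₃.Mt * projL c.eq₃.St))
noncomputable def D₂₂ : QTensor (addSize c.q₄ c.q₄) c.q₄ :=
  colBlock (projR c.J₄) (-projR c.J₃)
noncomputable def Ahat₂ : QTensor c.p₄ c.p₄ := -projL c.eq₃.Mt
noncomputable def Bhat₂ : QTensor c.q₄ c.q₄ := projR c.eq₃.Nt
noncomputable def E₂₂ : QTensor c.p₄ c.q₄ := c.eq₃.partY - c.last.part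

/-- `(Â₁₁, B̂₁₁, Ê₁₁)`; the unknown is `Û₂`. -/
noncomputable def hat₁ : OneTerm c.p₁ c.p₂ c.q₂ c.q₁ :=
  ⟨projR c.A₁₁ * c.Ahat₁, c.Bhat₁ * projL c.D₁₁, projR c.A₁₁ * c.E₁₁ * projL c.D₁₁⟩

/-- `(Â₂₂, B̂₂₂, Ê₂₂)`; the unknown is `K̂₂`. -/
noncomputable def hat₂ : OneTerm c.p₄ c.p₄ c.q₄ c.q₄ :=
  ⟨projR c.A₂₂ * c.Ahat₂, c.Bhat₂ * projL c.D₂₂, projR c.A₂₂ * c.E₂₂ * projL c.D₂₂⟩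

/-! Tensors built from the two expressions for `Z₂` and the two expressions for `Z₃`. -/

noncomputable def Abar₁ : QTensor c.p₂ (addSize c.p₂ c.p₂) :=
  rowBlock (-(projL c.eq₁.Mt * projL c.eq₁.St)) (projL c.F₂)
noncomputable def Bbar₁ : QTensor (addSize c.q₂ c.q₂) c.q₂ :=
  colBlock (-projR c.J₁) (projR c.G₂)
noncomputable def Fbar₁ : QTensor c.p₂ c.p₃ := mpInv c.F₂ * c.eq₂.St
noncomputable def Gbar₁ : QTensor c.q₃ c.q₂ := projR c.eq₂.Nt * c.J₂ * mpInv c.G₂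
noncomputable def Hbar₁ : QTensor c.p₂ c.p₂ := projL c.eq₁.Mt
noncomputable def Jbar₁ : QTensor c.q₂ c.q₂ := projR c.eq₁.Nt
noncomputable def Ebar₁ : QTensor c.p₂ c.q₂ := -c.eq₁.partY + c.eq₂.partX
noncomputable def Abar₂ : QTensor c.p₃ (addSize c.p₃ c.p₃) :=
  rowBlock (-(projL c.eq₂.Mt * projL c.eq₂.St)) (projL c.F₃)
noncomputable def Bbar₂ : QTensor (addSize c.q₃ c.q₃) c.q₃ :=
  colBlock (-projR c.J₂) (projR c.G₃)
noncomputable def Fbar₂ : QTensor c.p₃ c.p₄ := mpInv c.F₃ * c.eq₃.St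
noncomputable def Gbar₂ : QTensor c.q₄ c.q₃ := projR c.eq₃.Nt * c.J₃ * mpInv c.G₃
noncomputable def Hbar₂ : QTensor c.p₃ c.p₃ := projL c.eq₂.Mt
noncomputable def Jbar₂ : QTensor c.q₃ c.q₃ := projR c.eq₂.Nt
noncomputable def Ebar₂ : QTensor c.p₃ c.q₃ := -c.eq₂.partY + c.eq₃.partX

/-- `(F̄₁₁, Ḡ₁₁, H̄₁₁, J̄₁₁, Ē₁₁)`; the unknowns are `V̂₂` and `Û₂`. -/
noncomputable def bar₁ : TwoTerm c.p₂ c.p₃ c.p₂ c.q₃ c.q₂ c.q₂ :=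
  ⟨projR c.Abar₁ * c.Fbar₁, c.Gbar₁ * projL c.Bbar₁, projR c.Abar₁ * c.Hbar₁,
    c.Jbar₁ * projL c.Bbar₁, projR c.Abar₁ * c.Ebar₁ * projL c.Bbar₁⟩

/-- `(F̄₂₂, Ḡ₂₂, H̄₂₂, J̄₂₂, Ē₂₂)`; the unknowns are `K̂₂` and `V̂₂`. -/
noncomputable def bar₂ : TwoTerm c.p₃ c.p₄ c.p₃ c.q₄ c.q₃ c.q₃ :=
  ⟨projR c.Abar₂ * c.Fbar₂, c.Gbar₂ * projL c.Bbar₂, projR c.Abar₂ * c.Hbar₂,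
    c.Jbar₂ * projL c.Bbar₂, projR c.Abar₂ * c.Ebar₂ * projL c.Bbar₂⟩

/-! Tensors built from the two expressions for `V̂₂`. -/

noncomputable def Adbar : QTensor c.p₃ (addSize c.p₃ c.p₃) :=
  rowBlock (projL c.bar₁.F) (-(projL c.bar₂.Mt * projL c.bar₂.St))
noncomputable def Bdbar : QTensor (addSize c.q₃ c.q₃) c.q₃ :=
  colBlock (projR c.bar₁.G) (-projR c.bar₂.J)
noncomputable def Fdbar : QTensor c.p₃ c.p₂ := mpInv c.bar₁.F * c.bar₁.St
noncomputable def Gdbar : QTensor c.q₂ c.q₃ := projR c.bar₁.Nt * c.bar₁.J * mpInv c.bar₁.G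
noncomputable def Hdbar : QTensor c.p₃ c.p₃ := projL c.bar₂.Mt
noncomputable def Jdbar : QTensor c.q₃ c.q₃ := projR c.bar₂.Nt
noncomputable def Edbar : QTensor c.p₃ c.q₃ := c.bar₁.partX - c.bar₂.partY

/-- The doubly barred `(F₁₁, G₁₁, H₁₁, J₁₁, E₁₁)`; the unknowns are `P₄₄` and `Q₅₅`. -/
noncomputable def dbar : TwoTerm c.p₃ c.p₂ c.p₃ c.q₂ c.q₃ c.q₃ :=
  ⟨projR c.Adbar * c.Fdbar, c.Gdbar * projL c.Bdbar, projR c.Adbar * c.Hdbar,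
    c.Jdbar * projL c.Bdbar, projR c.Adbar * c.Edbar * projL c.Bdbar⟩

/-! Tensors built from the two expressions for `Û₂` and the two expressions for `K̂₂`. -/

noncomputable def Atil₁ : QTensor c.p₂ (addSize c.p₂ c.p₂) :=
  rowBlock (projL c.bar₁.Mt * projL c.bar₁.St) (-projL c.hat₁.A)
noncomputable def Btil₁ : QTensor (addSize c.q₂ c.q₂) c.q₂ :=
  colBlock (projR c.bar₁.J) (-projR c.hat₁.B)
noncomputable def Ctil₁ : QTensor c.p₂ c.p₂ := projL c.bar₁.Mt
noncomputable def Dtil₁ : QTensor c.q₂ c.q₂ := projR c.bar₁.Nt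
noncomputable def Etil₁ : QTensor c.p₂ c.q₂ := c.hat₁.part - c.bar₁.partY
noncomputable def Atil₂ : QTensor c.p₄ (addSize c.p₄ c.p₄) :=
  rowBlock (projL c.hat₂.A) (-projL c.bar₂.F)
noncomputable def Btil₂ : QTensor (addSize c.q₄ c.q₄) c.q₄ :=
  colBlock (projR c.hat₂.B) (-projR c.bar₂.G)
noncomputable def Ctil₂ : QTensor c.p₄ c.p₃ := mpInv c.bar₂.F * c.bar₂.St
noncomputable def Dtil₂ : QTensor c.q₃ c.q₄ := projR c.bar₂.Nt * c.bar₂.J * mpInv c.bar₂.G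
noncomputable def Etil₂ : QTensor c.p₄ c.q₄ := c.bar₂.partX - c.hat₂.part

/-- `(C̃₁₁, D̃₁₁, Ẽ₁₁)`; the unknown is `P₄₄`. -/
noncomputable def til₁ : OneTerm c.p₂ c.p₂ c.q₂ c.q₂ :=
  ⟨projR c.Atil₁ * c.Ctil₁, c.Dtil₁ * projL c.Btil₁, projR c.Atil₁ * c.Etil₁ * projL c.Btil₁⟩

/-- `(C̃₂₂, D̃₂₂, Ẽ₂₂)`; the unknown is `Q₅₅`. -/
noncomputable def til₂ : OneTerm c.p₄ c.p₃ c.q₃ c.q₄ :=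
  ⟨projR c.Atil₂ * c.Ctil₂, c.Dtil₂ * projL c.Btil₂, projR c.Atil₂ * c.Etil₂ * projL c.Btil₂⟩

/-! Tensors built from the two expressions for `P₄₄` and the two expressions for `Q₅₅`.  The
right-hand sides `Ẽ_i`, `Ẽ_ii` of this second stage are called `EEtil_i` and `dtil_i.E`, to keep
them apart from those of the preceding stage. -/

noncomputable def Ftil₁ : QTensor c.p₂ (addSize c.p₂ c.p₂) :=
  rowBlock (projL c.til₁.A) (-projL c.dbar.F)
noncomputable def Gtil₁ : QTensor (addSize c.q₂ c.q₂) c.q₂ :=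
  colBlock (projR c.til₁.B) (-projR c.dbar.G)
noncomputable def Htil₁ : QTensor c.p₂ c.p₃ := mpInv c.dbar.F * c.dbar.St
noncomputable def Jtil₁ : QTensor c.q₃ c.q₂ := projR c.dbar.Nt * c.dbar.J * mpInv c.dbar.G
noncomputable def EEtil₁ : QTensor c.p₂ c.q₂ := c.dbar.partX - c.til₁.part
noncomputable def Ftil₂ : QTensor c.p₃ (addSize c.p₃ c.p₃) :=
  rowBlock (projL c.dbar.Mt * projL c.dbar.St) (-projL c.til₂.A)
noncomputable def Gtil₂ : QTensor (addSize c.q₃ c.q₃) c.q₃ :=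
  colBlock (projR c.dbar.J) (-projR c.til₂.B)
noncomputable def Htil₂ : QTensor c.p₃ c.p₃ := projL c.dbar.Mt
noncomputable def Jtil₂ : QTensor c.q₃ c.q₃ := projR c.dbar.Nt
noncomputable def EEtil₂ : QTensor c.p₃ c.q₃ := c.til₂.part - c.dbar.partY

/-- `(H̃₁₁, J̃₁₁, Ẽ₁₁)`; the unknown is `K₄₄`. -/
noncomputable def dtil₁ : OneTerm c.p₂ c.p₃ c.q₃ c.q₂ :=
  ⟨projR c.Ftil₁ * c.Htil₁, c.Jtil₁ * projL c.Gtil₁, projR c.Ftil₁ * c.EEtil₁ * projL c.Gtil₁⟩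

/-- `(H̃₂₂, J̃₂₂, Ẽ₂₂)`; the unknown is `K₄₄`. -/
noncomputable def dtil₂ : OneTerm c.p₃ c.p₃ c.q₃ c.q₃ :=
  ⟨projR c.Ftil₂ * c.Htil₂, c.Jtil₂ * projL c.Gtil₂, projR c.Ftil₂ * c.EEtil₂ * projL c.Gtil₂⟩

/-! Tensors built from the two expressions for `K₄₄`. -/

noncomputable def Atil : QTensor c.p₃ (addSize c.p₃ c.p₃) :=
  rowBlock (projL c.dtil₁.A) (-projL c.dtil₂.A)
noncomputable def Btil : QTensor (addSize c.q₃ c.q₃) c.q₃ :=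
  colBlock (projR c.dtil₁.B) (-projR c.dtil₂.B)
noncomputable def Etil : QTensor c.p₃ c.q₃ := c.dtil₂.part - c.dtil₁.part

/-- The solvability conditions. -/
def SolvabilityConditions : Prop :=
  (c.eq₁.Cond ∧ c.eq₂.Cond ∧ c.eq₃.Cond) ∧
  (c.first.Cond ∧ c.last.Cond) ∧
  (c.hat₁.Cond ∧ c.hat₂.Cond) ∧
  (c.bar₁.Cond ∧ c.bar₂.Cond) ∧
  c.dbar.Cond ∧
  (c.til₁.Cond ∧ c.til₂.Cond) ∧
  (c.dtil₁.Cond ∧ c.dtil₂.Cond) ∧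
  projR c.Atil * c.Etil * projL c.Btil = 0

/-! ### The general solution -/

/-- The arbitrary tensors of the general solution: three for every unknown for which two
expressions are equated. -/
structure Params where
  forK₄₄ : Free c.p₃ c.q₃
  forP₄₄ : Free c.p₂ c.q₂
  forQ₅₅ : Free c.p₃ c.q₃
  forV₂ : Free c.p₃ c.q₃
  forU₂ : Free c.p₂ c.q₂
  forK₂ : Free c.p₄ c.q₄
  forZ₁ : Free c.p₁ c.q₁
  forZ₂ : Free c.p₂ c.q₂
  forZ₃ : Free c.p₃ c.q₃
  forZ₄ : Free c.p₄ c.q₄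

variable {c} (w : c.Params)

namespace Params

/-- `K₄₄`, from `(H̃₁₁, J̃₁₁, Ẽ₁₁)`. -/
noncomputable def K₄₄ : QTensor c.p₃ c.q₃ :=
  c.dtil₁.gen (w.forK₄₄.X₁ c.Atil c.Btil c.Etil) (w.forK₄₄.Y₁ c.Atil c.Btil c.Etil)

/-- `K₄₄`, from `(H̃₂₂, J̃₂₂, Ẽ₂₂)`. -/
noncomputable def K₄₄alt : QTensor c.p₃ c.q₃ :=
  c.dtil₂.gen (w.forK₄₄.X₂ c.Atil c.Btil c.Etil) (w.forK₄₄.Y₂ c.Atil c.Btil c.Etil)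

noncomputable def rhsP₄₄ : QTensor c.p₂ c.q₂ := c.EEtil₁ - c.Htil₁ * w.K₄₄ * c.Jtil₁
noncomputable def W₈₈ := w.forP₄₄.X₁ c.Ftil₁ c.Gtil₁ w.rhsP₄₄
noncomputable def K₅₅ := w.forP₄₄.X₂ c.Ftil₁ c.Gtil₁ w.rhsP₄₄
noncomputable def W₉₉ := w.forP₄₄.Y₁ c.Ftil₁ c.Gtil₁ w.rhsP₄₄
noncomputable def K₆₆ := w.forP₄₄.Y₂ c.Ftil₁ c.Gtil₁ w.rhsP₄₄

noncomputable def rhsQ₅₅ : QTensor c.p₃ c.q₃ := c.EEtil₂ - c.Htil₂ * w.K₄₄ * c.Jtil₂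
noncomputable def K₇₇ := w.forQ₅₅.X₁ c.Ftil₂ c.Gtil₂ w.rhsQ₅₅
noncomputable def T₁₁ := w.forQ₅₅.X₂ c.Ftil₂ c.Gtil₂ w.rhsQ₅₅
noncomputable def K₈₈ := w.forQ₅₅.Y₁ c.Ftil₂ c.Gtil₂ w.rhsQ₅₅
noncomputable def T₂₂ := w.forQ₅₅.Y₂ c.Ftil₂ c.Gtil₂ w.rhsQ₅₅

noncomputable def P₄₄ : QTensor c.p₂ c.q₂ := c.dbar.genX w.K₄₄ w.K₅₅ w.K₆₆
noncomputable def P₄₄alt : QTensor c.p₂ c.q₂ := c.til₁.gen w.W₈₈ w.W₉₉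
noncomputable def Q₅₅ : QTensor c.p₃ c.q₃ := c.dbar.genY w.K₇₇ w.K₄₄ w.K₈₈
noncomputable def Q₅₅alt : QTensor c.p₃ c.q₃ := c.til₂.gen w.T₁₁ w.T₂₂

noncomputable def rhsV₂ : QTensor c.p₃ c.q₃ :=
  -c.Edbar + c.Fdbar * w.P₄₄ * c.Gdbar + c.Hdbar * w.Q₅₅ * c.Jdbar
noncomputable def P₅₅ := w.forV₂.X₁ c.Adbar c.Bdbar w.rhsV₂
noncomputable def Q₇₇ := w.forV₂.X₂ c.Adbar c.Bdbar w.rhsV₂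
noncomputable def P₆₆ := w.forV₂.Y₁ c.Adbar c.Bdbar w.rhsV₂
noncomputable def Q₈₈ := w.forV₂.Y₂ c.Adbar c.Bdbar w.rhsV₂

noncomputable def rhsU₂ : QTensor c.p₂ c.q₂ := c.Etil₁ - c.Ctil₁ * w.P₄₄ * c.Dtil₁
noncomputable def Q₄₄ := w.forU₂.X₁ c.Atil₁ c.Btil₁ w.rhsU₂
noncomputable def V₇₇ := w.forU₂.X₂ c.Atil₁ c.Btil₁ w.rhsU₂
noncomputable def Q₆₆ := w.forU₂.Y₁ c.Atil₁ c.Btil₁ w.rhsU₂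
noncomputable def V₈₈ := w.forU₂.Y₂ c.Atil₁ c.Btil₁ w.rhsU₂

noncomputable def rhsK₂ : QTensor c.p₄ c.q₄ := c.Etil₂ - c.Ctil₂ * w.Q₅₅ * c.Dtil₂
noncomputable def V₉₉ := w.forK₂.X₁ c.Atil₂ c.Btil₂ w.rhsK₂
noncomputable def P₇₇ := w.forK₂.X₂ c.Atil₂ c.Btil₂ w.rhsK₂
noncomputable def W₁₁ := w.forK₂.Y₁ c.Atil₂ c.Btil₂ w.rhsK₂
noncomputable def P₈₈ := w.forK₂.Y₂ c.Atil₂ c.Btil₂ w.rhsK₂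

noncomputable def V₂ : QTensor c.p₃ c.q₃ := c.bar₁.genX w.P₄₄ w.P₅₅ w.P₆₆
noncomputable def V₂alt : QTensor c.p₃ c.q₃ := c.bar₂.genY w.Q₇₇ w.Q₅₅ w.Q₈₈
noncomputable def U₂ : QTensor c.p₂ c.q₂ := c.bar₁.genY w.Q₄₄ w.P₄₄ w.Q₆₆
noncomputable def U₂alt : QTensor c.p₂ c.q₂ := c.hat₁.gen w.V₇₇ w.V₈₈
noncomputable def K₂ : QTensor c.p₄ c.q₄ := c.bar₂.genX w.Q₅₅ w.P₇₇ w.P₈₈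
noncomputable def K₂alt : QTensor c.p₄ c.q₄ := c.hat₂.gen w.V₉₉ w.W₁₁

noncomputable def rhsZ₂ : QTensor c.p₂ c.q₂ :=
  -c.Ebar₁ + c.Fbar₁ * w.V₂ * c.Gbar₁ + c.Hbar₁ * w.U₂ * c.Jbar₁
noncomputable def U₁ := w.forZ₂.X₁ c.Abar₁ c.Bbar₁ w.rhsZ₂
noncomputable def V₄ := w.forZ₂.X₂ c.Abar₁ c.Bbar₁ w.rhsZ₂
noncomputable def U₃ := w.forZ₂.Y₁ c.Abar₁ c.Bbar₁ w.rhsZ₂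
noncomputable def V₅ := w.forZ₂.Y₂ c.Abar₁ c.Bbar₁ w.rhsZ₂

noncomputable def rhsZ₃ : QTensor c.p₃ c.q₃ :=
  -c.Ebar₂ + c.Fbar₂ * w.K₂ * c.Gbar₂ + c.Hbar₂ * w.V₂ * c.Jbar₂
noncomputable def V₁ := w.forZ₃.X₁ c.Abar₂ c.Bbar₂ w.rhsZ₃
noncomputable def K₄ := w.forZ₃.X₂ c.Abar₂ c.Bbar₂ w.rhsZ₃
noncomputable def V₃ := w.forZ₃.Y₁ c.Abar₂ c.Bbar₂ w.rhsZ₃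
noncomputable def K₅ := w.forZ₃.Y₂ c.Abar₂ c.Bbar₂ w.rhsZ₃

noncomputable def rhsZ₁ : QTensor c.p₁ c.q₁ := c.E₁₁ - c.Ahat₁ * w.U₂ * c.Bhat₁
noncomputable def W₁ := w.forZ₁.X₁ c.A₁₁ c.D₁₁ w.rhsZ₁
noncomputable def U₄ := w.forZ₁.X₂ c.A₁₁ c.D₁₁ w.rhsZ₁
noncomputable def W₂ := w.forZ₁.Y₁ c.A₁₁ c.D₁₁ w.rhsZ₁
noncomputable def U₅ := w.forZ₁.Y₂ c.A₁₁ c.D₁₁ w.rhsZ₁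

noncomputable def rhsZ₄ : QTensor c.p₄ c.q₄ := c.E₂₂ - c.Ahat₂ * w.K₂ * c.Bhat₂
noncomputable def What₁ := w.forZ₄.X₁ c.A₂₂ c.D₂₂ w.rhsZ₄
noncomputable def K₁ := w.forZ₄.X₂ c.A₂₂ c.D₂₂ w.rhsZ₄
noncomputable def W₃ := w.forZ₄.Y₁ c.A₂₂ c.D₂₂ w.rhsZ₄
noncomputable def K₃ := w.forZ₄.Y₂ c.A₂₂ c.D₂₂ w.rhsZ₄

/-- `Z₁ = F₄† E₄ G₄† + L_{F₄} W₁ + W₂ R_{G₄}`. -/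
noncomputable def Z₁ : QTensor c.p₁ c.q₁ := c.first.gen w.W₁ w.W₂

/-- The expression for `Z₁` that comes from the equation with right-hand side `E₁`. -/
noncomputable def Z₁alt : QTensor c.p₁ c.q₁ := c.eq₁.genX w.U₂ w.U₄ w.U₅

/-- `Z₂`, as the second unknown of the equation with right-hand side `E₁`. -/
noncomputable def Z₂ : QTensor c.p₂ c.q₂ := c.eq₁.genY w.U₁ w.U₂ w.U₃

/-- `Z₂`, as the first unknown of the equation with right-hand side `E₂`. -/
noncomputable def Z₂alt : QTensor c.p₂ c.q₂ := c.eq₂.genX w.V₂ w.V₄ w.V₅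

/-- `Z₃`, as the second unknown of the equation with right-hand side `E₂`. -/
noncomputable def Z₃ : QTensor c.p₃ c.q₃ := c.eq₂.genY w.V₁ w.V₂ w.V₃

/-- `Z₃`, as the first unknown of the equation with right-hand side `E₃`. -/
noncomputable def Z₃alt : QTensor c.p₃ c.q₃ := c.eq₃.genX w.K₂ w.K₄ w.K₅

/-- `Z₄ = H₄† E₅ J₄† + L_{H₄} Ŵ₁ + W₃ R_{J₄}`. -/
noncomputable def Z₄ : QTensor c.p₄ c.q₄ := c.last.gen w.What₁ w.W₃

/-- The expression for `Z₄` that comes from the equation with right-hand side `E₃`. -/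
noncomputable def Z₄alt : QTensor c.p₄ c.q₄ := c.eq₃.genY w.K₁ w.K₂ w.K₃

/-- All pairs of expressions for the same tensor agree. -/
def Agree : Prop :=
  (w.Z₁ = w.Z₁alt ∧ w.Z₂ = w.Z₂alt ∧ w.Z₃ = w.Z₃alt ∧ w.Z₄ = w.Z₄alt) ∧
  (w.U₂ = w.U₂alt ∧ w.V₂ = w.V₂alt ∧ w.K₂ = w.K₂alt) ∧
  (w.P₄₄ = w.P₄₄alt ∧ w.Q₅₅ = w.Q₅₅alt ∧ w.K₄₄ = w.K₄₄alt)

end Params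

end CoupledSystem

end EinsteinTensor

/-!
The proof rests on three linear equations over the quaternions: the one-term equation
`A X B = E`, the two-term equation `F X G + H Y J = E`, and the four-block equation
`A' X₁ + A'' X₂ + Y₁ B' + Y₂ B'' = C`.  For each of them the solvability conditions are necessary,
the general form solves the equation when they hold, and every solution has the general form
(`OneTerm.cond_of_eq`, `OneTerm.gen_solves`, `OneTerm.exists_gen_eq`, their analogues for `TwoTerm`,
and `Free.blocks_solve`, `Free.exists_blocks_eq`).

The coupled system is a chain in which each unknown occurs in two neighbouring equations.  Writing
the unknowns of every equation in general form gives two expressions for each unknown.  Equating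
them is a four-block equation for the outer parameters (the lemmas `gen_eq_genX_iff` and its
variants), and its solvability condition is a one- or two-term equation for the inner parameters,
those shared by the two unknowns of a two-term equation (`mul_sub_mul_eq_zero_iff`,
`mul_neg_add_add_mul_eq_zero_iff`).  These equations form a chain with one unknown fewer.  After
four rounds, with unknowns `Z₁, Z₂, Z₃, Z₄`, then `U₂, V₂, K₂`, then `P₄₄, Q₅₅`, then `K₄₄`, no
unknown is left, only the condition `R_Ã Ẽ L_B̃ = 0`.  Following a given solution down the levels
yields all conditions and the parameters; going up the levels from arbitrary free tensors yields
the agreement of all pairs of expressions and a solution.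

Positive lengths of the size vectors are needed only for the blocks: for a size vector of length
`0` there is a single multi-index, and the two blocks of a block tensor would share it.
-/

namespace EinsteinTensor

/-! ### Identities for the Moore–Penrose inverse and its projections -/

section MoorePenrose

variable {N M K : ℕ} {I : Fin N → ℕ} {J : Fin M → ℕ} {L : Fin K → ℕ}

theorem mul_mpInv_mul (D : QTensor I J) : D * mpInv D * D = D := (mpInv_spec D).1

theorem mpInv_mul_mpInv (D : QTensor I J) : mpInv D * D * mpInv D = mpInv D := (mpInv_spec D).2.1

theorem projR_mul_self (D : QTensor I J) : projR D * D = 0 := by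
  rw [projR, Matrix.sub_mul, Matrix.one_mul, mul_mpInv_mul, sub_self]

theorem mul_projL_self (D : QTensor I J) : D * projL D = 0 := by
  rw [projL, Matrix.mul_sub, Matrix.mul_one, ← Matrix.mul_assoc, mul_mpInv_mul, sub_self]

theorem projR_conjTranspose (D : QTensor I J) : (projR D).conjTranspose = projR D := by
  rw [projR, Matrix.conjTranspose_sub, Matrix.conjTranspose_one, (mpInv_spec D).2.2.1]

theorem projL_conjTranspose (D : QTensor I J) : (projL D).conjTranspose = projL D := by
  rw [projL, Matrix.conjTranspose_sub, Matrix.conjTranspose_one, (mpInv_spec D).2.2.2]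

theorem projR_mul_projR (D : QTensor I J) : projR D * projR D = projR D := by
  nth_rw 2 [projR]
  rw [Matrix.mul_sub, Matrix.mul_one, ← Matrix.mul_assoc, projR_mul_self, Matrix.zero_mul, sub_zero]

theorem projL_mul_projL (D : QTensor I J) : projL D * projL D = projL D := by
  nth_rw 1 [projL]
  rw [Matrix.sub_mul, Matrix.one_mul, Matrix.mul_assoc, mul_projL_self, Matrix.mul_zero, sub_zero]

/-- The Moore–Penrose inverse of `P * H`, for an orthogonal projection `P`, absorbs `P`, since
its kernel is the orthogonal complement of the column space of `P * H`. -/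
theorem mpInv_mul_projection {P : QTensor I I} {H : QTensor I J} (hP : P * P = P)
    (hP' : P.conjTranspose = P) : mpInv (P * H) * P = mpInv (P * H) := by
  have h := (mpInv_spec (P * H)).2.2.1
  have h1 : P * H * mpInv (P * H) * P = P * H * mpInv (P * H) := by
    have h2 : P * (P * H * mpInv (P * H)) = P * H * mpInv (P * H) := by
      simp only [← Matrix.mul_assoc, hP]
    have h3 := congrArg Matrix.conjTranspose h2
    rwa [Matrix.conjTranspose_mul, h, hP'] at h3
  calc mpInv (P * H) * P = mpInv (P * H) * (P * H * mpInv (P * H) * P) := by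
        conv_lhs => rw [← mpInv_mul_mpInv]
        simp only [Matrix.mul_assoc]
    _ = mpInv (P * H) := by rw [h1, ← Matrix.mul_assoc, mpInv_mul_mpInv]

/-- The Moore–Penrose inverse of `H * P`, for an orthogonal projection `P`, absorbs `P`, since
its column space is that of `P * H*`. -/
theorem projection_mul_mpInv {P : QTensor J J} {H : QTensor I J} (hP : P * P = P)
    (hP' : P.conjTranspose = P) : P * mpInv (H * P) = mpInv (H * P) := by
  have h := (mpInv_spec (H * P)).2.2.2
  have h1 : P * (mpInv (H * P) * (H * P)) = mpInv (H * P) * (H * P) := by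
    have h2 : mpInv (H * P) * (H * P) * P = mpInv (H * P) * (H * P) := by
      simp only [Matrix.mul_assoc, hP]
    have h3 := congrArg Matrix.conjTranspose h2
    rwa [Matrix.conjTranspose_mul, h, hP'] at h3
  calc P * mpInv (H * P) = P * (mpInv (H * P) * (H * P)) * mpInv (H * P) := by
        conv_lhs => rw [← mpInv_mul_mpInv]
        simp only [Matrix.mul_assoc]
    _ = mpInv (H * P) := by rw [h1, mpInv_mul_mpInv]

theorem mul_mpInv_mul_of_projR_mul {D : QTensor I J} {X : QTensor I L} (h : projR D * X = 0) :
    D * mpInv D * X = X := by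
  rw [projR, Matrix.sub_mul, Matrix.one_mul, sub_eq_zero] at h
  exact h.symm

theorem mul_mpInv_mul_of_mul_projL {D : QTensor I J} {X : QTensor L J} (h : X * projL D = 0) :
    X * (mpInv D * D) = X := by
  rw [projL, Matrix.mul_sub, Matrix.mul_one, sub_eq_zero] at h
  exact h.symm

end MoorePenrose

/-! ### The one-term equation `A * X * B = E` -/

namespace OneTerm

variable {N M : ℕ} {a p : Fin N → ℕ} {q b : Fin M → ℕ} (t : OneTerm a p q b)

theorem cond_of_eq {X : QTensor p q} (h : t.A * X * t.B = t.E) : t.Cond := by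
  constructor
  · rw [← h, ← Matrix.mul_assoc, ← Matrix.mul_assoc, projR_mul_self, Matrix.zero_mul,
      Matrix.zero_mul]
  · rw [← h, Matrix.mul_assoc, mul_projL_self, Matrix.mul_zero]

theorem gen_solves (h : t.Cond) (W W' : QTensor p q) : t.A * t.gen W W' * t.B = t.E := by
  have h1 : t.A * (projL t.A * W) = 0 := by rw [← Matrix.mul_assoc, mul_projL_self, Matrix.zero_mul]
  have h2 : t.A * (W' * projR t.B) * t.B = 0 := by
    rw [Matrix.mul_assoc, Matrix.mul_assoc, projR_mul_self, Matrix.mul_zero, Matrix.mul_zero]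
  rw [gen, Matrix.mul_add, Matrix.mul_add, Matrix.add_mul, Matrix.add_mul, h1, h2, part,
    Matrix.zero_mul, add_zero, add_zero]
  calc t.A * (mpInv t.A * t.E * mpInv t.B) * t.B
      = t.A * mpInv t.A * t.E * (mpInv t.B * t.B) := by simp only [Matrix.mul_assoc]
    _ = t.E := by rw [mul_mpInv_mul_of_projR_mul h.1, mul_mpInv_mul_of_mul_projL h.2]

theorem exists_gen_eq {X : QTensor p q} (h : t.A * X * t.B = t.E) :
    ∃ W W', X = t.gen W W' := by
  refine ⟨X, mpInv t.A * t.A * X, ?_⟩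
  rw [gen, part, ← h, projL, projR]
  simp only [Matrix.mul_sub, Matrix.sub_mul, Matrix.mul_one, Matrix.one_mul, Matrix.mul_assoc]
  abel

end OneTerm

/-! ### The two-term equation `F * X * G + H * Y * J = E` -/

namespace TwoTerm

variable {N M : ℕ} {a p p' : Fin N → ℕ} {q q' b : Fin M → ℕ} (t : TwoTerm a p p' q q' b)

theorem mpInv_Mt_mul_projR : mpInv t.Mt * projR t.F = mpInv t.Mt :=
  mpInv_mul_projection (projR_mul_projR _) (projR_conjTranspose _)

theorem projL_mul_mpInv_Nt : projL t.G * mpInv t.Nt = mpInv t.Nt :=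
  projection_mul_mpInv (projL_mul_projL _) (projL_conjTranspose _)

theorem projL_mul_mpInv_St : projL t.Mt * mpInv t.St = mpInv t.St :=
  projection_mul_mpInv (projL_mul_projL _) (projL_conjTranspose _)

/-- The column space of `S` lies in that of `F`. -/
theorem F_mul_mpInv_mul_St : t.F * mpInv t.F * t.St = t.St := by
  apply mul_mpInv_mul_of_projR_mul
  rw [St, ← Matrix.mul_assoc, ← Mt, mul_projL_self]

/-- The row space of `R_N J` lies in that of `G`. -/
theorem projR_Nt_mul_J : projR t.Nt * t.J * (mpInv t.G * t.G) = projR t.Nt * t.J := by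
  apply mul_mpInv_mul_of_mul_projL
  rw [Matrix.mul_assoc, ← Nt, projR_mul_self]

theorem H_mul_mpInv_mul_St : t.H * (mpInv t.St * t.St) = t.St := by
  rw [← t.projL_mul_mpInv_St, ← Matrix.mul_assoc, ← Matrix.mul_assoc, ← St, mul_mpInv_mul]

theorem St_mul_mpInv_H_mul_H : t.St * (mpInv t.H * t.H) = t.St := by
  have h : t.Mt * (mpInv t.H * t.H) = t.Mt := by
    rw [Mt, Matrix.mul_assoc, ← Matrix.mul_assoc t.H, mul_mpInv_mul]
  rw [St, projL, Matrix.mul_sub, Matrix.mul_one, Matrix.sub_mul, ← Matrix.mul_assoc t.H (mpInv t.H),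
    mul_mpInv_mul, Matrix.mul_assoc, Matrix.mul_assoc, h]

theorem cond_of_eq {X : QTensor p q} {Y : QTensor p' q'}
    (h : t.F * X * t.G + t.H * Y * t.J = t.E) : t.Cond := by
  have hF : projR t.F * t.E = t.Mt * Y * t.J := by
    rw [← h, Matrix.mul_add, Mt, ← Matrix.mul_assoc, ← Matrix.mul_assoc, projR_mul_self]
    simp only [Matrix.zero_mul, zero_add, Matrix.mul_assoc]
  have hG : t.E * projL t.G = t.H * Y * t.Nt := by
    rw [← h, Matrix.add_mul, Nt, Matrix.mul_assoc _ t.G, mul_projL_self]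
    simp only [Matrix.mul_zero, zero_add, Matrix.mul_assoc]
  refine ⟨?_, ?_, ?_, ?_⟩
  · rw [Matrix.mul_assoc, hF, ← Matrix.mul_assoc, ← Matrix.mul_assoc, projR_mul_self,
      Matrix.zero_mul, Matrix.zero_mul]
  · rw [hG, Matrix.mul_assoc, mul_projL_self, Matrix.mul_zero]
  · rw [hF, Matrix.mul_assoc, mul_projL_self, Matrix.mul_zero]
  · rw [Matrix.mul_assoc, hG, ← Matrix.mul_assoc, ← Matrix.mul_assoc, projR_mul_self,
      Matrix.zero_mul, Matrix.zero_mul]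

/-- With `T = H * M† * E + S * H† * E * N† * J`, the left-hand side is `E * G† * G + T * L_G`, and
the four conditions give `T * L_G = E * L_G`. -/
theorem part_solves (h : t.Cond) : t.F * t.partX * t.G + t.H * t.partY * t.J = t.E := by
  obtain ⟨h1, h2, h3, h4⟩ := h
  -- The conditions let every projection in the two particular solutions act trivially on `E`.
  have e1 : mpInv t.Mt * t.E = mpInv t.Mt * (projR t.F * t.E) := by
    rw [← Matrix.mul_assoc, t.mpInv_Mt_mul_projR]
  have e2 : mpInv t.Mt * t.E * (mpInv t.J * t.J) = mpInv t.Mt * t.E := by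
    apply mul_mpInv_mul_of_mul_projL
    rw [e1, Matrix.mul_assoc, h3, Matrix.mul_zero]
  have e3 : t.Mt * (mpInv t.Mt * t.E) = projR t.F * t.E := by
    rw [e1, ← Matrix.mul_assoc]
    apply mul_mpInv_mul_of_projR_mul
    rw [← Matrix.mul_assoc, h1]
  have e4 : t.F * mpInv t.F * t.H * (mpInv t.Mt * t.E)
      = t.H * (mpInv t.Mt * t.E) - projR t.F * t.E := by
    have : t.F * mpInv t.F * t.H = t.H - t.Mt := by
      rw [Mt, projR, Matrix.sub_mul, Matrix.one_mul]; abel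
    rw [this, Matrix.sub_mul, e3]
  have e5 : t.E * (mpInv t.Nt * t.Nt) = t.E * projL t.G := by
    have : mpInv t.Nt * t.Nt = projL t.G * (mpInv t.Nt * t.Nt) := by
      rw [← Matrix.mul_assoc, t.projL_mul_mpInv_Nt]
    rw [this, ← Matrix.mul_assoc]
    exact mul_mpInv_mul_of_mul_projL h2
  have e6 : t.St * mpInv t.H * (t.E * projL t.G)
      = t.E * projL t.G - t.H * (mpInv t.Mt * t.E) * projL t.G := by
    have h5 : t.H * mpInv t.H * (t.E * projL t.G) = t.E * projL t.G :=
      mul_mpInv_mul_of_projR_mul (by rw [← Matrix.mul_assoc, h4])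
    calc t.St * mpInv t.H * (t.E * projL t.G)
        = t.H * mpInv t.H * (t.E * projL t.G)
          - t.H * (mpInv t.Mt * (projR t.F * (t.H * mpInv t.H * (t.E * projL t.G)))) := by
          have hm : mpInv t.Mt * t.Mt = mpInv t.Mt * (projR t.F * t.H) := rfl
          rw [St, projL, hm, Matrix.mul_sub]
          simp only [Matrix.mul_one, Matrix.sub_mul, Matrix.mul_assoc]
      _ = _ := by
          rw [h5]
          simp only [← Matrix.mul_assoc]
          simp only [Matrix.mul_assoc t.H, t.mpInv_Mt_mul_projR]
  have x1 : t.F * t.partX * t.G = t.F * mpInv t.F * t.E * (mpInv t.G * t.G)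
      - t.F * mpInv t.F * t.H * (mpInv t.Mt * t.E) * (mpInv t.G * t.G)
      - t.F * mpInv t.F * t.St * mpInv t.H * t.E * mpInv t.Nt * t.J * (mpInv t.G * t.G) := by
    rw [partX]
    simp only [Matrix.mul_sub, Matrix.sub_mul, Matrix.mul_assoc]
  have y1 : t.H * t.partY * t.J = t.H * (mpInv t.Mt * t.E * (mpInv t.J * t.J))
      + t.H * (mpInv t.St * t.St) * mpInv t.H * t.E * mpInv t.Nt * t.J := by
    rw [partY]
    simp only [Matrix.mul_add, Matrix.add_mul, Matrix.mul_assoc]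
  have z1 : t.St * mpInv t.H * t.E * mpInv t.Nt * t.J
      = t.St * mpInv t.H * t.E * mpInv t.Nt * t.J * (mpInv t.G * t.G)
        + t.St * mpInv t.H * (t.E * (mpInv t.Nt * t.Nt)) := by
    rw [Nt, projL]
    simp only [Matrix.mul_sub, Matrix.mul_one, Matrix.mul_assoc]
    abel
  rw [e2, t.H_mul_mpInv_mul_St, z1, e5, e6] at y1
  rw [x1, y1, e4, t.F_mul_mpInv_mul_St, projL, projR]
  simp only [Matrix.mul_sub, Matrix.sub_mul, Matrix.mul_one, Matrix.one_mul, Matrix.mul_assoc]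
  abel

theorem gen_solves (h : t.Cond) (U₁ U₂ U₃ : QTensor p' q') (U₄ U₅ : QTensor p q) :
    t.F * t.genX U₂ U₄ U₅ * t.G + t.H * t.genY U₁ U₂ U₃ * t.J = t.E := by
  have hx : t.F * t.genX U₂ U₄ U₅ * t.G = t.F * t.partX * t.G - t.St * U₂ * projR t.Nt * t.J := by
    calc t.F * t.genX U₂ U₄ U₅ * t.G = t.F * t.partX * t.G
          - t.F * mpInv t.F * t.St * U₂ * (projR t.Nt * t.J * (mpInv t.G * t.G))
          + t.F * projL t.F * U₄ * t.G + t.F * U₅ * (projR t.G * t.G) := by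
          rw [genX]
          simp only [Matrix.mul_sub, Matrix.sub_mul, Matrix.mul_add, Matrix.add_mul,
            Matrix.mul_assoc]
      _ = _ := by
          rw [mul_projL_self, projR_mul_self, t.F_mul_mpInv_mul_St, t.projR_Nt_mul_J]
          simp only [Matrix.zero_mul, Matrix.mul_zero, add_zero, Matrix.mul_assoc]
  have hy : t.H * t.genY U₁ U₂ U₃ * t.J = t.H * t.partY * t.J + t.St * U₂ * projR t.Nt * t.J := by
    calc t.H * t.genY U₁ U₂ U₃ * t.J = t.H * t.partY * t.J
          + t.St * projL t.St * U₁ * t.J + t.St * U₂ * projR t.Nt * t.J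
          + t.H * U₃ * (projR t.J * t.J) := by
          rw [genY]
          nth_rw 2 [St]
          nth_rw 3 [St]
          simp only [Matrix.mul_add, Matrix.add_mul, Matrix.mul_assoc]
      _ = _ := by
          rw [mul_projL_self, projR_mul_self]
          simp only [Matrix.zero_mul, Matrix.mul_zero, add_zero]
  rw [hx, hy, ← t.part_solves h]
  abel

/-- Every solution is of the general form, with `U₂ = Y`: that choice makes the terms of the first
unknown in `E` and `U₂` add up to `F† (E - H Y J) G† = F† F X G G†`. -/
theorem exists_gen_eq {X : QTensor p q} {Y : QTensor p' q'}
    (h : t.F * X * t.G + t.H * Y * t.J = t.E) :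
    ∃ U₁ U₂ U₃ U₄ U₅, X = t.genX U₂ U₄ U₅ ∧ Y = t.genY U₁ U₂ U₃ := by
  have hF : projR t.F * t.E = t.Mt * Y * t.J := by
    rw [← h, Matrix.mul_add, Mt, ← Matrix.mul_assoc, ← Matrix.mul_assoc, projR_mul_self]
    simp only [Matrix.zero_mul, zero_add, Matrix.mul_assoc]
  have hG : t.E * projL t.G = t.H * Y * t.Nt := by
    rw [← h, Matrix.add_mul, Nt, Matrix.mul_assoc _ t.G, mul_projL_self]
    simp only [Matrix.mul_zero, zero_add, Matrix.mul_assoc]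
  have hM : mpInv t.Mt * t.E = mpInv t.Mt * t.Mt * Y * t.J := by
    rw [← t.mpInv_Mt_mul_projR, Matrix.mul_assoc, hF]
    simp only [← Matrix.mul_assoc, t.mpInv_Mt_mul_projR]
  have hN : t.St * mpInv t.H * t.E * mpInv t.Nt = t.St * Y * (t.Nt * mpInv t.Nt) := by
    calc t.St * mpInv t.H * t.E * mpInv t.Nt
        = t.St * mpInv t.H * (t.E * projL t.G) * mpInv t.Nt := by
          conv_lhs => rw [← t.projL_mul_mpInv_Nt]
          simp only [Matrix.mul_assoc]
      _ = t.St * (mpInv t.H * t.H) * Y * (t.Nt * mpInv t.Nt) := by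
          rw [hG]; simp only [Matrix.mul_assoc]
      _ = _ := by rw [t.St_mul_mpInv_H_mul_H]
  refine ⟨Y * (t.Nt * mpInv t.Nt), Y, mpInv t.Mt * t.Mt * Y, X, mpInv t.F * t.F * X, ?_, ?_⟩
  · have h1 : mpInv t.F * (t.E - t.H * (mpInv t.Mt * t.E) -
        t.St * mpInv t.H * t.E * mpInv t.Nt * t.J - t.St * Y * projR t.Nt * t.J) * mpInv t.G
        = mpInv t.F * (t.F * X * t.G) * mpInv t.G := by
      rw [hM, hN, ← h, St, projL, projR]
      congr 2
      simp only [Matrix.mul_sub, Matrix.sub_mul, Matrix.mul_one, Matrix.mul_assoc]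
      abel
    calc X = mpInv t.F * (t.F * X * t.G) * mpInv t.G + projL t.F * X
          + mpInv t.F * t.F * X * projR t.G := by
          rw [projL, projR]
          simp only [Matrix.mul_sub, Matrix.sub_mul, Matrix.mul_one, Matrix.one_mul,
            Matrix.mul_assoc]
          abel
      _ = _ := by
          rw [← h1, genX, partX]
          simp only [Matrix.mul_sub, Matrix.sub_mul, Matrix.mul_assoc]
  · have h2 : mpInv t.St * t.St * mpInv t.H * t.E * mpInv t.Nt
        = mpInv t.St * t.St * Y * (t.Nt * mpInv t.Nt) := by
      calc _ = mpInv t.St * (t.St * mpInv t.H * t.E * mpInv t.Nt) := by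
            simp only [Matrix.mul_assoc]
        _ = _ := by rw [hN]; simp only [Matrix.mul_assoc]
    have h3 : projL t.Mt * projL t.St = projL t.Mt - mpInv t.St * t.St := by
      nth_rw 2 [projL]
      rw [Matrix.mul_sub, Matrix.mul_one, ← Matrix.mul_assoc, t.projL_mul_mpInv_St]
    rw [genY, partY, h2, hM, h3, projR, projR, projL]
    simp only [Matrix.mul_sub, Matrix.sub_mul, Matrix.mul_one, Matrix.one_mul, Matrix.mul_assoc]
    abel

end TwoTerm

/-! ### Block tensors and the equation `A' * X₁ + A'' * X₂ + Y₁ * B' + Y₂ * B'' = C` -/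

section Block

variable {N M : ℕ} {I : Fin N → ℕ} {J K : Fin M → ℕ}

theorem rowBlock_eq_mul_add_mul {L L' : Fin N → ℕ} (A : QTensor I L) (B : QTensor I L') :
    rowBlock A B = A * rowBlock (1 : QTensor L L) (0 : QTensor L L')
      + B * rowBlock (0 : QTensor L' L) (1 : QTensor L' L') := by
  ext1 i l
  simp only [Matrix.add_apply, Matrix.mul_apply, rowBlock]
  split_ifs <;> simp [Matrix.one_apply]

theorem colBlock_eq_mul_add_mul {L L' : Fin N → ℕ} (A : QTensor L J) (B : QTensor L' J) :
    colBlock A B = colBlock (1 : QTensor L L) (0 : QTensor L' L) * A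
      + colBlock (0 : QTensor L L') (1 : QTensor L' L') * B := by
  ext1 l i
  simp only [Matrix.add_apply, Matrix.mul_apply, colBlock]
  split_ifs <;> simp [Matrix.one_apply]

/-- The embedding of multi-indices of size `J` as the first block of those of size `J + K`. -/
def castAddIdx (k : MIdx J) : MIdx (addSize J K) := fun s => Fin.castAdd (K s) (k s)

/-- The embedding of multi-indices of size `K` as the last block of those of size `J + K`. -/
def natAddIdx (k : MIdx K) : MIdx (addSize J K) := fun s => Fin.natAdd (J s) (k s)

theorem rowBlock_one_zero : rowBlock (1 : QTensor J J) (0 : QTensor J K)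
    = (1 : QTensor (addSize J K) (addSize J K)).submatrix castAddIdx id := by
  ext1 i l
  simp only [rowBlock, Matrix.submatrix_apply, Matrix.one_apply, id, Matrix.zero_apply, dite_eq_ite,
    ite_self]
  have key : castAddIdx i = l ↔ ∃ h : ∀ s, (l s : ℕ) < J s, i = fun s => ⟨l s, h s⟩ := by
    constructor
    · rintro rfl
      exact ⟨fun s => (i s).isLt, rfl⟩
    · rintro ⟨h, rfl⟩
      rfl
  by_cases h : ∀ s, (l s : ℕ) < J s
  · simp [key, h]
  · simp [key, h]

theorem rowBlock_zero_one (hM : 0 < M) : rowBlock (0 : QTensor K J) (1 : QTensor K K)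
    = (1 : QTensor (addSize J K) (addSize J K)).submatrix natAddIdx id := by
  ext1 i l
  simp only [rowBlock, Matrix.submatrix_apply, Matrix.one_apply, id, Matrix.zero_apply]
  have key : natAddIdx i = l ↔ ∃ h : ∀ s, J s ≤ (l s : ℕ),
      i = fun s => ⟨(l s : ℕ) - J s, by 
        have h1 : (l s : ℕ) < J s + K s := (l s).isLt
        have h2 := h s
        omega⟩ := by
    constructor
    · rintro rfl
      refine ⟨fun s => Nat.le_add_right _ _, ?_⟩
      funext s
      simp [natAddIdx]
    · rintro ⟨h, rfl⟩
      funext s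
      simp [natAddIdx, h s]
  by_cases h : ∀ s, (l s : ℕ) < J s
  · -- the two blocks are disjoint because there is at least one index position
    have h' : ¬ ∀ s, J s ≤ (l s : ℕ) := fun h' => absurd (h ⟨0, hM⟩) (not_lt.2 (h' _))
    simp [key, h, h']
  · by_cases h' : ∀ s, J s ≤ (l s : ℕ)
    · simp [key, h, h']
    · simp [key, h, h']

theorem colBlock_one_zero : colBlock (1 : QTensor J J) (0 : QTensor K J)
    = (rowBlock (1 : QTensor J J) (0 : QTensor J K)).transpose := by
  ext1 l i
  simp only [rowBlock, colBlock, Matrix.transpose_apply, Matrix.one_apply, eq_comm]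
  rfl

theorem colBlock_zero_one : colBlock (0 : QTensor J K) (1 : QTensor K K)
    = (rowBlock (0 : QTensor K J) (1 : QTensor K K)).transpose := by
  ext1 l i
  simp only [rowBlock, colBlock, Matrix.transpose_apply, Matrix.one_apply, eq_comm]
  rfl

theorem colBlock_castAddIdx {L L' : Fin N → ℕ} (A : QTensor L J) (B : QTensor L' J) :
    (colBlock A B).submatrix castAddIdx id = A := by
  ext1 l i
  have h : ∀ s, (castAddIdx l s : Fin (L s + L' s)).val < L s := fun s => (l s).isLt
  rw [Matrix.submatrix_apply, colBlock, dif_pos h]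
  rfl

theorem colBlock_natAddIdx (hN : 0 < N) {L L' : Fin N → ℕ} (A : QTensor L J) (B : QTensor L' J) :
    (colBlock A B).submatrix natAddIdx id = B := by
  ext1 l i
  have h' : ∀ s, L s ≤ (natAddIdx l s : Fin (L s + L' s)).val := fun s => Nat.le_add_right _ _
  have h : ¬ ∀ s, (natAddIdx l s : Fin (L s + L' s)).val < L s :=
    fun h => absurd (h ⟨0, hN⟩) (not_lt.2 (h' _))
  rw [Matrix.submatrix_apply, colBlock, dif_neg h, dif_pos h']
  congr 1
  funext s
  simp [natAddIdx]

theorem rowBlock_castAddIdx {L L' : Fin M → ℕ} (A : QTensor I L) (B : QTensor I L') :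
    (rowBlock A B).submatrix id castAddIdx = A := by
  ext1 i l
  have h : ∀ s, (castAddIdx l s : Fin (L s + L' s)).val < L s := fun s => (l s).isLt
  rw [Matrix.submatrix_apply, rowBlock, dif_pos h]
  rfl

theorem rowBlock_natAddIdx (hM : 0 < M) {L L' : Fin M → ℕ} (A : QTensor I L) (B : QTensor I L') :
    (rowBlock A B).submatrix id natAddIdx = B := by
  ext1 i l
  have h' : ∀ s, L s ≤ (natAddIdx l s : Fin (L s + L' s)).val := fun s => Nat.le_add_right _ _
  have h : ¬ ∀ s, (natAddIdx l s : Fin (L s + L' s)).val < L s :=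
    fun h => absurd (h ⟨0, hM⟩) (not_lt.2 (h' _))
  rw [Matrix.submatrix_apply, rowBlock, dif_neg h, dif_pos h']
  congr 1
  funext s
  simp [natAddIdx]

theorem mul_one_submatrix {m n o : Type} [Fintype n] [DecidableEq n]
    (A : Matrix m n (Quaternion ℝ)) (e : o → n) :
    A * (1 : Matrix n n (Quaternion ℝ)).submatrix id e = A.submatrix id e := by
  ext1 i j
  simp [Matrix.mul_apply, Matrix.one_apply]

theorem one_submatrix_mul {m n o : Type} [Fintype n] [DecidableEq n]
    (e : o → n) (A : Matrix n m (Quaternion ℝ)) :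
    (1 : Matrix n n (Quaternion ℝ)).submatrix e id * A = A.submatrix e id := by
  ext1 i j
  simp [Matrix.mul_apply, Matrix.one_apply]

/-- Any two tensors are the upper and lower block of some tensor. -/
theorem exists_rowBlock_mul_eq (hN : 0 < N) {p : Fin N → ℕ} (X₁ X₂ : QTensor p J) :
    ∃ X : QTensor (addSize p p) J, rowBlock (1 : QTensor p p) (0 : QTensor p p) * X = X₁ ∧
      rowBlock (0 : QTensor p p) (1 : QTensor p p) * X = X₂ := by
  refine ⟨colBlock X₁ X₂, ?_, ?_⟩
  · rw [rowBlock_one_zero, one_submatrix_mul]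
    exact colBlock_castAddIdx _ _
  · rw [rowBlock_zero_one hN, one_submatrix_mul]
    exact colBlock_natAddIdx hN _ _

/-- Any two tensors are the left and right block of some tensor. -/
theorem exists_mul_colBlock_eq (hM : 0 < M) {q : Fin M → ℕ} (Y₁ Y₂ : QTensor I q) :
    ∃ Y : QTensor I (addSize q q), Y * colBlock (1 : QTensor q q) (0 : QTensor q q) = Y₁ ∧
      Y * colBlock (0 : QTensor q q) (1 : QTensor q q) = Y₂ := by
  refine ⟨rowBlock Y₁ Y₂, ?_, ?_⟩
  · rw [colBlock_one_zero, rowBlock_one_zero, Matrix.transpose_submatrix, Matrix.transpose_one,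
      mul_one_submatrix]
    exact rowBlock_castAddIdx _ _
  · rw [colBlock_zero_one, rowBlock_zero_one hM, Matrix.transpose_submatrix, Matrix.transpose_one,
      mul_one_submatrix]
    exact rowBlock_natAddIdx hM _ _

end Block

namespace Free

variable {N M : ℕ} {p : Fin N → ℕ} {q : Fin M → ℕ}

theorem mul_X_add_Y_mul (v : Free p q) (A : QTensor p (addSize p p)) (B : QTensor (addSize q q) q)
    (C : QTensor p q) (h : projR A * C * projL B = 0) : A * v.X A B C + v.Y A B C * B = C := by
  have h1 := mul_mpInv_mul_of_mul_projL h
  calc A * v.X A B C + v.Y A B C * B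
      = A * mpInv A * C + projR A * C * (mpInv B * B) + A * projL A * v.V'
        + v.V'' * (projR B * B) := by
        rw [X, Y]
        simp only [Matrix.mul_add, Matrix.add_mul, Matrix.mul_sub, Matrix.mul_assoc]
        abel
    _ = C := by
        rw [h1, mul_projL_self, projR_mul_self, projR, Matrix.sub_mul, Matrix.one_mul,
          Matrix.zero_mul, Matrix.mul_zero]
        abel

theorem projR_mul_mul_projL_eq_zero {A : QTensor p (addSize p p)} {B : QTensor (addSize q q) q}
    {C : QTensor p q} {X : QTensor (addSize p p) q} {Y : QTensor p (addSize q q)}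
    (h : A * X + Y * B = C) : projR A * C * projL B = 0 := by
  rw [← h, Matrix.mul_add, ← Matrix.mul_assoc, projR_mul_self, Matrix.zero_mul, zero_add,
    Matrix.mul_assoc, Matrix.mul_assoc, mul_projL_self, Matrix.mul_zero, Matrix.mul_zero]

theorem exists_X_eq_Y_eq {A : QTensor p (addSize p p)} {B : QTensor (addSize q q) q}
    {C : QTensor p q} {X : QTensor (addSize p p) q} {Y : QTensor p (addSize q q)}
    (h : A * X + Y * B = C) : ∃ v : Free p q, v.X A B C = X ∧ v.Y A B C = Y := by
  refine ⟨⟨mpInv A * Y, X, projR A * Y⟩, ?_, ?_⟩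
  · rw [Free.X, ← h, projL]
    simp only [Matrix.mul_add, Matrix.sub_mul, Matrix.one_mul, Matrix.mul_assoc]
    abel
  · have h1 : projR A * C = projR A * (Y * B) := by
      rw [← h, Matrix.mul_add, ← Matrix.mul_assoc, projR_mul_self, Matrix.zero_mul, zero_add]
    rw [Free.Y, h1, projR, projR]
    simp only [Matrix.mul_sub, Matrix.sub_mul, Matrix.one_mul, Matrix.mul_one, Matrix.mul_assoc]
    abel

variable {A' A'' : QTensor p p} {B' B'' : QTensor q q} {C : QTensor p q}

/-- When the solvability condition holds, the four blocks read off for any choice of the free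
tensors solve the four-block equation. -/
theorem blocks_solve (v : Free p q)
    (h : projR (rowBlock A' A'') * C * projL (colBlock B' B'') = 0) :
    A' * v.X₁ (rowBlock A' A'') (colBlock B' B'') C + A'' * v.X₂ (rowBlock A' A'') (colBlock B' B'') C
      + v.Y₁ (rowBlock A' A'') (colBlock B' B'') C * B'
      + v.Y₂ (rowBlock A' A'') (colBlock B' B'') C * B'' = C := by
  have h1 := v.mul_X_add_Y_mul _ _ _ h
  rw [X₁, X₂, Y₁, Y₂]
  generalize v.X _ _ C = X at *
  generalize v.Y _ _ C = Y at *
  rw [rowBlock_eq_mul_add_mul, colBlock_eq_mul_add_mul] at h1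
  rw [← h1]
  simp only [Matrix.mul_add, Matrix.add_mul, Matrix.mul_assoc, add_assoc]

/-- A solution of the four-block equation forces its solvability condition and arises from some
choice of the free tensors. -/
theorem exists_blocks_eq (hN : 0 < N) (hM : 0 < M) {X₁ X₂ Y₁ Y₂ : QTensor p q}
    (h : A' * X₁ + A'' * X₂ + Y₁ * B' + Y₂ * B'' = C) :
    projR (rowBlock A' A'') * C * projL (colBlock B' B'') = 0 ∧
      ∃ v : Free p q, v.X₁ (rowBlock A' A'') (colBlock B' B'') C = X₁ ∧
        v.X₂ (rowBlock A' A'') (colBlock B' B'') C = X₂ ∧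
        v.Y₁ (rowBlock A' A'') (colBlock B' B'') C = Y₁ ∧
        v.Y₂ (rowBlock A' A'') (colBlock B' B'') C = Y₂ := by
  obtain ⟨X, hX₁, hX₂⟩ := exists_rowBlock_mul_eq hN X₁ X₂
  obtain ⟨Y, hY₁, hY₂⟩ := exists_mul_colBlock_eq hM Y₁ Y₂
  have h1 : rowBlock A' A'' * X + Y * colBlock B' B'' = C := by
    rw [rowBlock_eq_mul_add_mul, colBlock_eq_mul_add_mul, ← h, ← hX₁, ← hX₂, ← hY₁, ← hY₂]
    simp only [Matrix.mul_add, Matrix.add_mul, Matrix.mul_assoc, add_assoc]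
  obtain ⟨v, hX, hY⟩ := exists_X_eq_Y_eq h1
  refine ⟨projR_mul_mul_projL_eq_zero h1, v, ?_, ?_, ?_, ?_⟩
  · rw [Free.X₁, hX, hX₁]
  · rw [Free.X₂, hX, hX₂]
  · rw [Free.Y₁, hY, hY₁]
  · rw [Free.Y₂, hY, hY₂]

end Free

/-! ### Equating two general solutions -/

section Equate

variable {N M : ℕ} {p a a' p₁ p₂ : Fin N → ℕ} {q b b' q₁ q₂ : Fin M → ℕ}

theorem OneTerm.gen_eq_gen_iff (t : OneTerm a p q b) (t' : OneTerm a' p q b')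
    (W W' T T' : QTensor p q) :
    t.gen W W' = t'.gen T T' ↔
      projL t.A * W + -projL t'.A * T + W' * projR t.B + T' * -projR t'.B
        = t'.part - t.part := by
  apply eq_iff_eq_of_sub_eq_sub
  simp only [gen, Matrix.neg_mul, Matrix.mul_neg]
  abel

theorem OneTerm.gen_eq_genX_iff (t : OneTerm a p q b) (t' : TwoTerm a' p p₁ q q₁ b')
    (W W' U₄ U₅ : QTensor p q) (U₂ : QTensor p₁ q₁) :
    t.gen W W' = t'.genX U₂ U₄ U₅ ↔
      projL t.A * W + -projL t'.F * U₄ + W' * projR t.B + U₅ * -projR t'.G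
        = t'.partX - t.part
          - mpInv t'.F * t'.St * U₂ * (projR t'.Nt * t'.J * mpInv t'.G) := by
  apply eq_iff_eq_of_sub_eq_sub
  simp only [gen, TwoTerm.genX, Matrix.neg_mul, Matrix.mul_neg, Matrix.mul_assoc]
  abel

theorem OneTerm.gen_eq_genY_iff (t : OneTerm a p q b) (t' : TwoTerm a' p₁ p q₁ q b')
    (W W' U₁ U₂ U₃ : QTensor p q) :
    t.gen W W' = t'.genY U₁ U₂ U₃ ↔
      projL t.A * W + -(projL t'.Mt * projL t'.St) * U₁ + W' * projR t.B + U₃ * -projR t'.J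
        = t'.partY - t.part - -projL t'.Mt * U₂ * projR t'.Nt := by
  apply eq_iff_eq_of_sub_eq_sub
  simp only [gen, TwoTerm.genY, Matrix.neg_mul, Matrix.mul_neg, Matrix.mul_assoc]
  abel

theorem TwoTerm.genY_eq_gen_iff (t : TwoTerm a' p₁ p q₁ q b') (t' : OneTerm a p q b)
    (W W' U₁ U₂ U₃ : QTensor p q) :
    t.genY U₁ U₂ U₃ = t'.gen W W' ↔
      projL t.Mt * projL t.St * U₁ + -projL t'.A * W + U₃ * projR t.J + W' * -projR t'.B
        = t'.part - t.partY - projL t.Mt * U₂ * projR t.Nt := by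
  apply eq_iff_eq_of_sub_eq_sub
  simp only [OneTerm.gen, genY, Matrix.neg_mul, Matrix.mul_neg, Matrix.mul_assoc]
  abel

theorem TwoTerm.genY_eq_genX_iff (t : TwoTerm a p₁ p q₁ q b) (t' : TwoTerm a' p p₂ q q₂ b')
    (U₁ U₂ U₃ V₄ V₅ : QTensor p q) (V₂ : QTensor p₂ q₂) :
    t.genY U₁ U₂ U₃ = t'.genX V₂ V₄ V₅ ↔
      -(projL t.Mt * projL t.St) * U₁ + projL t'.F * V₄ + U₃ * -projR t.J + V₅ * projR t'.G
        = -(-t.partY + t'.partX)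
          + mpInv t'.F * t'.St * V₂ * (projR t'.Nt * t'.J * mpInv t'.G)
          + projL t.Mt * U₂ * projR t.Nt := by
  rw [eq_comm]
  apply eq_iff_eq_of_sub_eq_sub
  simp only [genX, genY, Matrix.neg_mul, Matrix.mul_neg, Matrix.mul_assoc]
  abel

theorem TwoTerm.genX_eq_genY_iff (t : TwoTerm a p p₁ q q₁ b) (t' : TwoTerm a' p₂ p q₂ q b')
    (U₄ U₅ V₁ V₂ V₃ : QTensor p q) (U₂ : QTensor p₁ q₁) :
    t.genX U₂ U₄ U₅ = t'.genY V₁ V₂ V₃ ↔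
      projL t.F * U₄ + -(projL t'.Mt * projL t'.St) * V₁ + U₅ * projR t.G + V₃ * -projR t'.J
        = -(t.partX - t'.partY)
          + mpInv t.F * t.St * U₂ * (projR t.Nt * t.J * mpInv t.G)
          + projL t'.Mt * V₂ * projR t'.Nt := by
  apply eq_iff_eq_of_sub_eq_sub
  simp only [genX, genY, Matrix.neg_mul, Matrix.mul_neg, Matrix.mul_assoc]
  abel

/-- The solvability condition of the equation that determines the outer parameters is a one-term
equation for the parameter left in its right-hand side. -/
theorem mul_sub_mul_eq_zero_iff (R : QTensor p a) (L : QTensor b q) (E : QTensor a b)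
    (A : QTensor a p₁) (U : QTensor p₁ q₁) (B : QTensor q₁ b) :
    R * (E - A * U * B) * L = 0 ↔ R * A * U * (B * L) = R * E * L := by
  rw [eq_comm (a := R * A * U * (B * L)), ← sub_eq_zero (a := R * E * L)]
  simp only [Matrix.mul_sub, Matrix.sub_mul, Matrix.mul_assoc]

/-- The solvability condition of the equation that determines the outer parameters is a two-term
equation for the two parameters left in its right-hand side. -/
theorem mul_neg_add_add_mul_eq_zero_iff (R : QTensor p a) (L : QTensor b q) (E : QTensor a b)
    (F : QTensor a p₁) (V : QTensor p₁ q₁) (G : QTensor q₁ b)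
    (H : QTensor a p₂) (U : QTensor p₂ q₂) (J : QTensor q₂ b) :
    R * (-E + F * V * G + H * U * J) * L = 0 ↔
      R * F * V * (G * L) + R * H * U * (J * L) = R * E * L := by
  rw [← sub_eq_zero (b := R * E * L)]
  simp only [Matrix.mul_add, Matrix.add_mul, Matrix.mul_neg, Matrix.neg_mul, Matrix.mul_assoc]
  apply iff_of_eq
  congr 1
  abel

end Equate

/-! ### Ascent: the parametrized tensors agree and solve the system -/

namespace CoupledSystem

variable {N M : ℕ} {c : CoupledSystem N M}

/-- Under the solvability conditions the equations are solved level by level upwards from `K₄₄`: once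
the two expressions for the unknowns of one level agree, these unknowns satisfy the equations that
are the solvability conditions for the parameters of the level above. -/
theorem Params.agree_and_isSolution (h : c.SolvabilityConditions) (w : c.Params) :
    w.Agree ∧ c.IsSolution w.Z₁ w.Z₂ w.Z₃ w.Z₄ := by
  obtain ⟨⟨h₁, h₂, h₃⟩, ⟨h₄, h₅⟩, ⟨hh₁, hh₂⟩, ⟨hb₁, hb₂⟩, hd, ⟨ht₁, ht₂⟩, ⟨hs₁, hs₂⟩, hlast⟩ := h
  have eK₄₄ : w.K₄₄ = w.K₄₄alt :=
    (OneTerm.gen_eq_gen_iff ..).2 (w.forK₄₄.blocks_solve hlast)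
  have k₁ : c.dtil₁.A * w.K₄₄ * c.dtil₁.B = c.dtil₁.E := c.dtil₁.gen_solves hs₁ _ _
  have k₂ : c.dtil₂.A * w.K₄₄ * c.dtil₂.B = c.dtil₂.E := by
    rw [eK₄₄]; exact c.dtil₂.gen_solves hs₂ _ _
  have eP₄₄ : w.P₄₄ = w.P₄₄alt := Eq.symm <|
    (OneTerm.gen_eq_genX_iff ..).2
      (w.forP₄₄.blocks_solve ((mul_sub_mul_eq_zero_iff ..).2 k₁))
  have eQ₅₅ : w.Q₅₅ = w.Q₅₅alt :=
    (TwoTerm.genY_eq_gen_iff ..).2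
      (w.forQ₅₅.blocks_solve ((mul_sub_mul_eq_zero_iff ..).2 k₂))
  have d : c.dbar.F * w.P₄₄ * c.dbar.G + c.dbar.H * w.Q₅₅ * c.dbar.J = c.dbar.E :=
    c.dbar.gen_solves hd _ _ _ _ _
  have p : c.til₁.A * w.P₄₄ * c.til₁.B = c.til₁.E := by
    rw [eP₄₄]; exact c.til₁.gen_solves ht₁ _ _
  have q : c.til₂.A * w.Q₅₅ * c.til₂.B = c.til₂.E := by
    rw [eQ₅₅]; exact c.til₂.gen_solves ht₂ _ _
  have eV₂ : w.V₂ = w.V₂alt :=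
    (TwoTerm.genX_eq_genY_iff ..).2
      (w.forV₂.blocks_solve ((mul_neg_add_add_mul_eq_zero_iff ..).2 d))
  have eU₂ : w.U₂ = w.U₂alt :=
    (TwoTerm.genY_eq_gen_iff ..).2
      (w.forU₂.blocks_solve ((mul_sub_mul_eq_zero_iff ..).2 p))
  have eK₂ : w.K₂ = w.K₂alt := Eq.symm <|
    (OneTerm.gen_eq_genX_iff ..).2
      (w.forK₂.blocks_solve ((mul_sub_mul_eq_zero_iff ..).2 q))
  have b₁ : c.bar₁.F * w.V₂ * c.bar₁.G + c.bar₁.H * w.U₂ * c.bar₁.J = c.bar₁.E :=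
    c.bar₁.gen_solves hb₁ _ _ _ _ _
  have b₂ : c.bar₂.F * w.K₂ * c.bar₂.G + c.bar₂.H * w.V₂ * c.bar₂.J = c.bar₂.E := by
    rw [eV₂]; exact c.bar₂.gen_solves hb₂ _ _ _ _ _
  have u : c.hat₁.A * w.U₂ * c.hat₁.B = c.hat₁.E := by
    rw [eU₂]; exact c.hat₁.gen_solves hh₁ _ _
  have k : c.hat₂.A * w.K₂ * c.hat₂.B = c.hat₂.E := by
    rw [eK₂]; exact c.hat₂.gen_solves hh₂ _ _
  have eZ₁ : w.Z₁ = w.Z₁alt :=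
    (OneTerm.gen_eq_genX_iff ..).2
      (w.forZ₁.blocks_solve ((mul_sub_mul_eq_zero_iff ..).2 u))
  have eZ₂ : w.Z₂ = w.Z₂alt :=
    (TwoTerm.genY_eq_genX_iff ..).2
      (w.forZ₂.blocks_solve ((mul_neg_add_add_mul_eq_zero_iff ..).2 b₁))
  have eZ₃ : w.Z₃ = w.Z₃alt :=
    (TwoTerm.genY_eq_genX_iff ..).2
      (w.forZ₃.blocks_solve ((mul_neg_add_add_mul_eq_zero_iff ..).2 b₂))
  have eZ₄ : w.Z₄ = w.Z₄alt :=
    (OneTerm.gen_eq_genY_iff ..).2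
      (w.forZ₄.blocks_solve ((mul_sub_mul_eq_zero_iff ..).2 k))
  refine ⟨⟨⟨eZ₁, eZ₂, eZ₃, eZ₄⟩, ⟨eU₂, eV₂, eK₂⟩, eP₄₄, eQ₅₅, eK₄₄⟩,
    c.first.gen_solves h₄ _ _, ?_, ?_, ?_, c.last.gen_solves h₅ _ _⟩
  · rw [eZ₁]; exact c.eq₁.gen_solves h₁ _ _ _ _ _
  · rw [eZ₂]; exact c.eq₂.gen_solves h₂ _ _ _ _ _
  · rw [eZ₃, eZ₄]; exact c.eq₃.gen_solves h₃ _ _ _ _ _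

/-! ### Descent: every solution is parametrized -/

/-- A solution forces all conditions and arises from some choice of the free tensors.  Each equation
of a level writes its unknowns in general form; two forms of the same unknown give a four-block
equation, whose solvability condition is an equation of the level below. -/
theorem IsSolution.conditions_and_exists_params (hN : 0 < N) (hM : 0 < M)
    {Z₁ : QTensor c.p₁ c.q₁} {Z₂ : QTensor c.p₂ c.q₂} {Z₃ : QTensor c.p₃ c.q₃}
    {Z₄ : QTensor c.p₄ c.q₄} (h : c.IsSolution Z₁ Z₂ Z₃ Z₄) :
    c.SolvabilityConditions ∧
      ∃ w : c.Params, Z₁ = w.Z₁ ∧ Z₂ = w.Z₂ ∧ Z₃ = w.Z₃ ∧ Z₄ = w.Z₄ := by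
  obtain ⟨h₄, h₁, h₂, h₃, h₅⟩ := h
  obtain ⟨W₁, W₂, z₁⟩ := c.first.exists_gen_eq h₄
  obtain ⟨U₁, U₂, U₃, U₄, U₅, z₁', z₂⟩ := c.eq₁.exists_gen_eq h₁
  obtain ⟨V₁, V₂, V₃, V₄, V₅, z₂', z₃⟩ := c.eq₂.exists_gen_eq h₂
  obtain ⟨K₁, K₂, K₃, K₄, K₅, z₃', z₄'⟩ := c.eq₃.exists_gen_eq h₃
  obtain ⟨What₁, W₃, z₄⟩ := c.last.exists_gen_eq h₅
  -- Equate the two expressions for each `Z_i`.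
  obtain ⟨cZ₁, fZ₁, aZ₁, -, dZ₁, -⟩ := Free.exists_blocks_eq hN hM
    ((OneTerm.gen_eq_genX_iff ..).1 (z₁.symm.trans z₁'))
  obtain ⟨cZ₂, fZ₂, aZ₂, -, dZ₂, -⟩ := Free.exists_blocks_eq hN hM
    ((TwoTerm.genY_eq_genX_iff ..).1 (z₂.symm.trans z₂'))
  obtain ⟨cZ₃, fZ₃, aZ₃, -, dZ₃, -⟩ := Free.exists_blocks_eq hN hM
    ((TwoTerm.genY_eq_genX_iff ..).1 (z₃.symm.trans z₃'))
  obtain ⟨cZ₄, fZ₄, aZ₄, -, dZ₄, -⟩ := Free.exists_blocks_eq hN hM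
    ((OneTerm.gen_eq_genY_iff ..).1 (z₄.symm.trans z₄'))
  have hh₁ : c.hat₁.A * U₂ * c.hat₁.B = c.hat₁.E := (mul_sub_mul_eq_zero_iff ..).1 cZ₁
  have hh₂ : c.hat₂.A * K₂ * c.hat₂.B = c.hat₂.E := (mul_sub_mul_eq_zero_iff ..).1 cZ₄
  have hb₁ : c.bar₁.F * V₂ * c.bar₁.G + c.bar₁.H * U₂ * c.bar₁.J = c.bar₁.E :=
    (mul_neg_add_add_mul_eq_zero_iff ..).1 cZ₂
  have hb₂ : c.bar₂.F * K₂ * c.bar₂.G + c.bar₂.H * V₂ * c.bar₂.J = c.bar₂.E :=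
    (mul_neg_add_add_mul_eq_zero_iff ..).1 cZ₃
  -- Equate the two expressions for each of `U₂`, `V₂`, `K₂`.
  obtain ⟨V₇₇, V₈₈, u⟩ := c.hat₁.exists_gen_eq hh₁
  obtain ⟨Q₄₄, P₄₄, Q₆₆, P₅₅, P₆₆, v, u'⟩ := c.bar₁.exists_gen_eq hb₁
  obtain ⟨Q₇₇, Q₅₅, Q₈₈, P₇₇, P₈₈, k, v'⟩ := c.bar₂.exists_gen_eq hb₂
  obtain ⟨V₉₉, W₁₁, k'⟩ := c.hat₂.exists_gen_eq hh₂
  obtain ⟨cU₂, fU₂, aU₂, -, dU₂, -⟩ := Free.exists_blocks_eq hN hM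
    ((TwoTerm.genY_eq_gen_iff ..).1 (u'.symm.trans u))
  obtain ⟨cV₂, fV₂, aV₂, -, dV₂, -⟩ := Free.exists_blocks_eq hN hM
    ((TwoTerm.genX_eq_genY_iff ..).1 (v.symm.trans v'))
  obtain ⟨cK₂, fK₂, -, aK₂, -, dK₂⟩ := Free.exists_blocks_eq hN hM
    ((OneTerm.gen_eq_genX_iff ..).1 (k'.symm.trans k))
  have ht₁ : c.til₁.A * P₄₄ * c.til₁.B = c.til₁.E := (mul_sub_mul_eq_zero_iff ..).1 cU₂
  have hd : c.dbar.F * P₄₄ * c.dbar.G + c.dbar.H * Q₅₅ * c.dbar.J = c.dbar.E :=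
    (mul_neg_add_add_mul_eq_zero_iff ..).1 cV₂
  have ht₂ : c.til₂.A * Q₅₅ * c.til₂.B = c.til₂.E := (mul_sub_mul_eq_zero_iff ..).1 cK₂
  -- Equate the two expressions for each of `P₄₄`, `Q₅₅`.
  obtain ⟨W₈₈, W₉₉, p⟩ := c.til₁.exists_gen_eq ht₁
  obtain ⟨K₇₇, K₄₄, K₈₈, K₅₅, K₆₆, p', q⟩ := c.dbar.exists_gen_eq hd
  obtain ⟨T₁₁, T₂₂, q'⟩ := c.til₂.exists_gen_eq ht₂
  obtain ⟨cP₄₄, fP₄₄, -, aP₄₄, -, dP₄₄⟩ := Free.exists_blocks_eq hN hM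
    ((OneTerm.gen_eq_genX_iff ..).1 (p.symm.trans p'))
  obtain ⟨cQ₅₅, fQ₅₅, aQ₅₅, -, dQ₅₅, -⟩ := Free.exists_blocks_eq hN hM
    ((TwoTerm.genY_eq_gen_iff ..).1 (q.symm.trans q'))
  have hs₁ : c.dtil₁.A * K₄₄ * c.dtil₁.B = c.dtil₁.E := (mul_sub_mul_eq_zero_iff ..).1 cP₄₄
  have hs₂ : c.dtil₂.A * K₄₄ * c.dtil₂.B = c.dtil₂.E := (mul_sub_mul_eq_zero_iff ..).1 cQ₅₅
  -- Equate the two expressions for `K₄₄`.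
  obtain ⟨T₃₃, T₄₄, m⟩ := c.dtil₁.exists_gen_eq hs₁
  obtain ⟨T₅₅, T₆₆, m'⟩ := c.dtil₂.exists_gen_eq hs₂
  obtain ⟨cK₄₄, fK₄₄, aK₄₄, -, dK₄₄, -⟩ := Free.exists_blocks_eq hN hM
    ((OneTerm.gen_eq_gen_iff ..).1 (m.symm.trans m'))
  refine ⟨⟨⟨c.eq₁.cond_of_eq h₁, c.eq₂.cond_of_eq h₂, c.eq₃.cond_of_eq h₃⟩,
    ⟨c.first.cond_of_eq h₄, c.last.cond_of_eq h₅⟩, ⟨c.hat₁.cond_of_eq hh₁, c.hat₂.cond_of_eq hh₂⟩,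
    ⟨c.bar₁.cond_of_eq hb₁, c.bar₂.cond_of_eq hb₂⟩, c.dbar.cond_of_eq hd,
    ⟨c.til₁.cond_of_eq ht₁, c.til₂.cond_of_eq ht₂⟩,
    ⟨c.dtil₁.cond_of_eq hs₁, c.dtil₂.cond_of_eq hs₂⟩, cK₄₄⟩, ?_⟩
  -- The free tensors were chosen for right-hand sides in the parameters of the given solution; the
  -- parameters computed from them are the same, by ascending through the levels again.
  let w : c.Params := ⟨fK₄₄, fP₄₄, fQ₅₅, fV₂, fU₂, fK₂, fZ₁, fZ₂, fZ₃, fZ₄⟩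
  have eK₄₄ : w.K₄₄ = K₄₄ := (congrArg₂ c.dtil₁.gen aK₄₄ dK₄₄).trans m.symm
  have eP₄₄ : w.P₄₄ = P₄₄ := by
    have r : w.rhsP₄₄ = c.EEtil₁ - c.Htil₁ * K₄₄ * c.Jtil₁ := by rw [Params.rhsP₄₄, eK₄₄]
    rw [Params.P₄₄, Params.K₅₅, Params.K₆₆, r, eK₄₄]
    exact (congrArg₂ (c.dbar.genX K₄₄) aP₄₄ dP₄₄).trans p'.symm
  have eQ₅₅ : w.Q₅₅ = Q₅₅ := by
    have r : w.rhsQ₅₅ = c.EEtil₂ - c.Htil₂ * K₄₄ * c.Jtil₂ := by rw [Params.rhsQ₅₅, eK₄₄]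
    rw [Params.Q₅₅, Params.K₇₇, Params.K₈₈, r, eK₄₄]
    exact (congrArg₂ (c.dbar.genY · K₄₄ ·) aQ₅₅ dQ₅₅).trans q.symm
  have eV₂ : w.V₂ = V₂ := by
    have r : w.rhsV₂ = -c.Edbar + c.Fdbar * P₄₄ * c.Gdbar + c.Hdbar * Q₅₅ * c.Jdbar := by
      rw [Params.rhsV₂, eP₄₄, eQ₅₅]
    rw [Params.V₂, Params.P₅₅, Params.P₆₆, r, eP₄₄]
    exact (congrArg₂ (c.bar₁.genX P₄₄) aV₂ dV₂).trans v.symm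
  have eU₂ : w.U₂ = U₂ := by
    have r : w.rhsU₂ = c.Etil₁ - c.Ctil₁ * P₄₄ * c.Dtil₁ := by rw [Params.rhsU₂, eP₄₄]
    rw [Params.U₂, Params.Q₄₄, Params.Q₆₆, r, eP₄₄]
    exact (congrArg₂ (c.bar₁.genY · P₄₄ ·) aU₂ dU₂).trans u'.symm
  have eK₂ : w.K₂ = K₂ := by
    have r : w.rhsK₂ = c.Etil₂ - c.Ctil₂ * Q₅₅ * c.Dtil₂ := by rw [Params.rhsK₂, eQ₅₅]
    rw [Params.K₂, Params.P₇₇, Params.P₈₈, r, eQ₅₅]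
    exact (congrArg₂ (c.bar₂.genX Q₅₅) aK₂ dK₂).trans k.symm
  refine ⟨w, ?_, ?_, ?_, ?_⟩
  · have r : w.rhsZ₁ = c.E₁₁ - c.Ahat₁ * U₂ * c.Bhat₁ := by rw [Params.rhsZ₁, eU₂]
    rw [Params.Z₁, Params.W₁, Params.W₂, r]
    exact z₁.trans (congrArg₂ c.first.gen aZ₁ dZ₁).symm
  · have r : w.rhsZ₂ = -c.Ebar₁ + c.Fbar₁ * V₂ * c.Gbar₁ + c.Hbar₁ * U₂ * c.Jbar₁ := by
      rw [Params.rhsZ₂, eV₂, eU₂]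
    rw [Params.Z₂, Params.U₁, Params.U₃, r, eU₂]
    exact z₂.trans (congrArg₂ (c.eq₁.genY · U₂ ·) aZ₂ dZ₂).symm
  · have r : w.rhsZ₃ = -c.Ebar₂ + c.Fbar₂ * K₂ * c.Gbar₂ + c.Hbar₂ * V₂ * c.Jbar₂ := by
      rw [Params.rhsZ₃, eK₂, eV₂]
    rw [Params.Z₃, Params.V₁, Params.V₃, r, eV₂]
    exact z₃.trans (congrArg₂ (c.eq₂.genY · V₂ ·) aZ₃ dZ₃).symm
  · have r : w.rhsZ₄ = c.E₂₂ - c.Ahat₂ * K₂ * c.Bhat₂ := by rw [Params.rhsZ₄, eK₂]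
    rw [Params.Z₄, Params.What₁, Params.W₃, r]
    exact z₄.trans (congrArg₂ c.last.gen aZ₄ dZ₄).symm

end CoupledSystem

end EinsteinTensor

theorem theorem4p1 (N M : ℕ) (hN : 0 < N) (hM : 0 < M) (c : EinsteinTensor.CoupledSystem N M) :
    (c.Consistent ↔ c.SolvabilityConditions) ∧
    (c.SolvabilityConditions →
      (∀ w : c.Params, w.Agree) ∧
      (∀ Z₁ Z₂ Z₃ Z₄, c.IsSolution Z₁ Z₂ Z₃ Z₄ ↔
        ∃ w : c.Params, Z₁ = w.Z₁ ∧ Z₂ = w.Z₂ ∧ Z₃ = w.Z₃ ∧ Z₄ = w.Z₄)) := by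
  refine ⟨⟨?_, fun h => ?_⟩, fun h => ⟨fun w => (w.agree_and_isSolution h).1, ?_⟩⟩
  · rintro ⟨Z₁, Z₂, Z₃, Z₄, h⟩
    exact (h.conditions_and_exists_params hN hM).1
  · let w : c.Params := ⟨⟨0, 0, 0⟩, ⟨0, 0, 0⟩, ⟨0, 0, 0⟩, ⟨0, 0, 0⟩, ⟨0, 0, 0⟩, ⟨0, 0, 0⟩,
      ⟨0, 0, 0⟩, ⟨0, 0, 0⟩, ⟨0, 0, 0⟩, ⟨0, 0, 0⟩⟩
    exact ⟨_, _, _, _, (w.agree_and_isSolution h).2⟩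
  · refine fun Z₁ Z₂ Z₃ Z₄ => ⟨fun hZ => (hZ.conditions_and_exists_params hN hM).2, ?_⟩
    rintro ⟨w, rfl, rfl, rfl, rfl⟩
    exact (w.agree_and_isSolution h).2
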